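/- Let $(M,g)$ be a compact smooth Riemannian manifold without boundary, of dimension $n\ge 3$. Let $\mathrm{Ric}$ be its Ricci tensor, $s=\mathrm{trace}_g\mathrm{Ric}$ its scalar curvature, $\mathrm{Ric}_0=\mathrm{Ric}-\frac{s}{n}g$ its traceless Ricci tensor and $dv_g$ its Riemannian volume measure. For a smooth one-form $\theta$ with $g$-dual vector field $\xi=\theta^\#$ put $$S\theta=\tfrac12 L_\xi g+\tfrac1n(\delta\theta)\,g,\qquad \delta\theta=-\mathrm{div}\,\xi .$$ A TT-tensor is a smooth symmetric covariant two-tensor $\varphi$ with $\mathrm{trace}_g\varphi=0$ and $\delta\varphi=-\mathrm{trace}_g\nabla\varphi=0$. (a) Let $\mathrm{Ric}_0=S\theta+\varphi^{TT}$ with a smooth one-form $\theta$ and a TT-tensor $\varphi^{TT}$, where $S\theta$ and $\varphi^{TT}$ are orthogonal for the $L^2$ inner product $\langle\varphi,\varphi'\rangle=\int_M g(\varphi,\varphi')\,dv_g$. If $\int_M L_\xi s\,dv_g=0$ for $\xi=\theta^\#$, or if $s$ is constant, then $\xi$ is a conformal Killing vector field, that is, $L_\xi g=f g$ for some smooth function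 $f$ on $M$, and $\varphi^{TT}=\mathrm{Ric}_0$. (b) If moreover $M$ is connected, then $s$ is constant if and only if $\mathrm{Ric}=\frac{s}{n}g+\varphi^{TT}$ for some TT-tensor $\varphi^{TT}$. -/

import Mathlib

open MeasureTheory
open scoped Manifold ContDiff

noncomputable section

namespace RiemGeom

/-! ### Riemannian geometry of a coordinate domain

Here `G` is a field of bilinear forms on `ℝⁿ`, the coordinate expression of a metric. Only its germ
at the point under consideration matters. -/

section Coordinates

variable {n : ℕ}

/-- The coordinate vector field `∂ᵢ`. -/
def coordVec (i : Fin n) : EuclideanSpace ℝ (Fin n) := EuclideanSpace.single i 1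

/-- The coordinate one-form `dxⁱ`. -/
def coordForm (i : Fin n) : EuclideanSpace ℝ (Fin n) →L[ℝ] ℝ := EuclideanSpace.proj i

/-- The Christoffel symbols `Γ(u, v)`, where
`G(Γ(u, v), w) = ½ (∂_u G(v, w) + ∂_v G(u, w) - ∂_w G(u, v))`. -/
def christoffel (G : EuclideanSpace ℝ (Fin n) →
      EuclideanSpace ℝ (Fin n) →L[ℝ] EuclideanSpace ℝ (Fin n) →L[ℝ] ℝ)
    (y u v : EuclideanSpace ℝ (Fin n)) : EuclideanSpace ℝ (Fin n) :=
  (1 / 2 : ℝ) • (G y).inverse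
    (fderiv ℝ G y u v + fderiv ℝ G y v u - ((fderiv ℝ G y).flip u).flip v)

/-- The curvature `R(u, v) w = ∇_u ∇_v w - ∇_v ∇_u w` of the Levi-Civita connection
`∇_u X = ∂_u X + Γ(u, X)`, for constant coordinate fields `u`, `v`, `w`. -/
def curvature (G : EuclideanSpace ℝ (Fin n) →
      EuclideanSpace ℝ (Fin n) →L[ℝ] EuclideanSpace ℝ (Fin n) →L[ℝ] ℝ)
    (y u v w : EuclideanSpace ℝ (Fin n)) : EuclideanSpace ℝ (Fin n) :=
  fderiv ℝ (fun z => christoffel G z v w) y u - fderiv ℝ (fun z => christoffel G z u w) y v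
    + christoffel G y u (christoffel G y v w) - christoffel G y v (christoffel G y u w)

/-- `Ric(v, w)`, the trace of `u ↦ R(u, v) w`. -/
def coordRicciFun (G : EuclideanSpace ℝ (Fin n) →
      EuclideanSpace ℝ (Fin n) →L[ℝ] EuclideanSpace ℝ (Fin n) →L[ℝ] ℝ)
    (y v w : EuclideanSpace ℝ (Fin n)) : ℝ :=
  ∑ i : Fin n, coordForm i (curvature G y (coordVec i) v w)

/-- The Ricci tensor `∑ Ric(∂ᵢ, ∂ⱼ) dxⁱ ⊗ dxʲ` as a bilinear form. -/
def coordRicci (G : EuclideanSpace ℝ (Fin n) →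
      EuclideanSpace ℝ (Fin n) →L[ℝ] EuclideanSpace ℝ (Fin n) →L[ℝ] ℝ)
    (y : EuclideanSpace ℝ (Fin n)) :
    EuclideanSpace ℝ (Fin n) →L[ℝ] EuclideanSpace ℝ (Fin n) →L[ℝ] ℝ :=
  ∑ i : Fin n, ∑ j : Fin n,
    coordRicciFun G y (coordVec i) (coordVec j) • (coordForm i).smulRight (coordForm j)

/-- The codifferential `δα = -tr_G ∇α = -∑ᵢ (∇_{∂ᵢ} α)((dxⁱ)^♯)` of a one-form `α`, where
`(∇_u α)(v) = ∂_u α(v) - α(Γ(u, v))`. -/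
def coordCodiff (G : EuclideanSpace ℝ (Fin n) →
      EuclideanSpace ℝ (Fin n) →L[ℝ] EuclideanSpace ℝ (Fin n) →L[ℝ] ℝ)
    (α : EuclideanSpace ℝ (Fin n) → EuclideanSpace ℝ (Fin n) →L[ℝ] ℝ)
    (y : EuclideanSpace ℝ (Fin n)) : ℝ :=
  -∑ i : Fin n,
    (fderiv ℝ α y (coordVec i) ((G y).inverse (coordForm i))
      - α y (christoffel G y (coordVec i) ((G y).inverse (coordForm i))))

/-- `(∇_u Φ)(v, w) = ∂_u Φ(v, w) - Φ(Γ(u, v), w) - Φ(v, Γ(u, w))` for a two-tensor `Φ`. -/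
def coordCovDeriv₂ (G Φ : EuclideanSpace ℝ (Fin n) →
      EuclideanSpace ℝ (Fin n) →L[ℝ] EuclideanSpace ℝ (Fin n) →L[ℝ] ℝ)
    (y u v w : EuclideanSpace ℝ (Fin n)) : ℝ :=
  fderiv ℝ Φ y u v w - Φ y (christoffel G y u v) w - Φ y v (christoffel G y u w)

/-- The divergence `(δΦ)(w) = -∑ᵢ (∇_{∂ᵢ} Φ)((dxⁱ)^♯, w)` of a symmetric two-tensor `Φ`. -/
def coordDiv₂ (G Φ : EuclideanSpace ℝ (Fin n) →
      EuclideanSpace ℝ (Fin n) →L[ℝ] EuclideanSpace ℝ (Fin n) →L[ℝ] ℝ)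
    (y w : EuclideanSpace ℝ (Fin n)) : ℝ :=
  -∑ i : Fin n, coordCovDeriv₂ G Φ y (coordVec i) ((G y).inverse (coordForm i)) w

/-- The Lie derivative `(L_X G)(u, v) = (∂_X G)(u, v) + G(∂_u X, v) + G(u, ∂_v X)`. -/
def coordLie (G : EuclideanSpace ℝ (Fin n) →
      EuclideanSpace ℝ (Fin n) →L[ℝ] EuclideanSpace ℝ (Fin n) →L[ℝ] ℝ)
    (X : EuclideanSpace ℝ (Fin n) → EuclideanSpace ℝ (Fin n))
    (y : EuclideanSpace ℝ (Fin n)) :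
    EuclideanSpace ℝ (Fin n) →L[ℝ] EuclideanSpace ℝ (Fin n) →L[ℝ] ℝ :=
  fderiv ℝ G y (X y)
    + (G y).bilinearComp (fderiv ℝ X y) (ContinuousLinearMap.id ℝ _)
    + (G y).bilinearComp (ContinuousLinearMap.id ℝ _) (fderiv ℝ X y)

end Coordinates

/-! ### Tensor fields on a manifold -/

section Manifold

/-- Vector fields (not necessarily continuous). -/
abbrev VField (n : ℕ) (M : Type*) [TopologicalSpace M]
    [ChartedSpace (EuclideanSpace ℝ (Fin n)) M] : Type _ :=
  (x : M) → TangentSpace (𝓡 n) x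

/-- One-forms (not necessarily continuous). -/
abbrev OneForm (n : ℕ) (M : Type*) [TopologicalSpace M]
    [ChartedSpace (EuclideanSpace ℝ (Fin n)) M] : Type _ :=
  (x : M) → TangentSpace (𝓡 n) x →L[ℝ] ℝ

/-- Covariant two-tensor fields (not necessarily symmetric or continuous). -/
abbrev TwoTensor (n : ℕ) (M : Type*) [TopologicalSpace M]
    [ChartedSpace (EuclideanSpace ℝ (Fin n)) M] : Type _ :=
  (x : M) → TangentSpace (𝓡 n) x →L[ℝ] TangentSpace (𝓡 n) x →L[ℝ] ℝ

/-- Smooth Riemannian metrics on `M`. -/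
abbrev Metric (n : ℕ) (M : Type*) [TopologicalSpace M]
    [ChartedSpace (EuclideanSpace ℝ (Fin n)) M] [IsManifold (𝓡 n) ∞ M] : Type _ :=
  Bundle.ContMDiffRiemannianMetric (𝓡 n) ∞ (EuclideanSpace ℝ (Fin n))
    (fun x : M => TangentSpace (𝓡 n) x)

variable {n : ℕ} {M : Type*} [TopologicalSpace M] [ChartedSpace (EuclideanSpace ℝ (Fin n)) M]

/-- Smoothness of a vector field. -/
def SmoothVField [IsManifold (𝓡 n) ∞ M] (X : VField n M) : Prop :=
  ContMDiff (𝓡 n) ((𝓡 n).prod 𝓘(ℝ, EuclideanSpace ℝ (Fin n))) ∞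
    (fun x => Bundle.TotalSpace.mk' (EuclideanSpace ℝ (Fin n)) x (X x))

/-- Smoothness of a one-form. -/
def SmoothOneForm [IsManifold (𝓡 n) ∞ M] (θ : OneForm n M) : Prop :=
  ContMDiff (𝓡 n) ((𝓡 n).prod 𝓘(ℝ, EuclideanSpace ℝ (Fin n) →L[ℝ] ℝ)) ∞
    (fun x => Bundle.TotalSpace.mk' (EuclideanSpace ℝ (Fin n) →L[ℝ] ℝ)
      (E := fun x : M => TangentSpace (𝓡 n) x →L[ℝ] ℝ) x (θ x))

/-- Smoothness of a two-tensor field. -/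
def SmoothTwoTensor [IsManifold (𝓡 n) ∞ M] (φ : TwoTensor n M) : Prop :=
  ContMDiff (𝓡 n)
    ((𝓡 n).prod 𝓘(ℝ, EuclideanSpace ℝ (Fin n) →L[ℝ] EuclideanSpace ℝ (Fin n) →L[ℝ] ℝ)) ∞
    (fun x => Bundle.TotalSpace.mk'
      (EuclideanSpace ℝ (Fin n) →L[ℝ] EuclideanSpace ℝ (Fin n) →L[ℝ] ℝ)
      (E := fun x : M => TangentSpace (𝓡 n) x →L[ℝ] TangentSpace (𝓡 n) x →L[ℝ] ℝ) x (φ x))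

/-- The pullback `(u, v) ↦ b(A u, A v)` of a bilinear form. -/
def pullForm {V W : Type*} [TopologicalSpace V] [AddCommGroup V] [Module ℝ V]
    [IsTopologicalAddGroup V] [ContinuousSMul ℝ V]
    [TopologicalSpace W] [AddCommGroup W] [Module ℝ W]
    [IsTopologicalAddGroup W] [ContinuousSMul ℝ W]
    (b : W →L[ℝ] W →L[ℝ] ℝ) (A : V →L[ℝ] W) : V →L[ℝ] V →L[ℝ] ℝ :=
  (ContinuousLinearMap.precomp ℝ A).comp (b.comp A)

@[simp]
theorem pullForm_apply {V W : Type*} [TopologicalSpace V] [AddCommGroup V] [Module ℝ V]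
    [IsTopologicalAddGroup V] [ContinuousSMul ℝ V]
    [TopologicalSpace W] [AddCommGroup W] [Module ℝ W]
    [IsTopologicalAddGroup W] [ContinuousSMul ℝ W]
    (b : W →L[ℝ] W →L[ℝ] ℝ) (A : V →L[ℝ] W) (u v : V) :
    pullForm b A u v = b (A u) (A v) := rfl

/-- The differential `T_x M → ℝⁿ` of the chart `e` at `x`. -/
def chartDeriv (e : OpenPartialHomeomorph M (EuclideanSpace ℝ (Fin n))) (x : M) :
    TangentSpace (𝓡 n) x →L[ℝ] EuclideanSpace ℝ (Fin n) :=
  mfderiv (𝓡 n) 𝓘(ℝ, EuclideanSpace ℝ (Fin n)) e x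

/-- The differential `ℝⁿ → T_{e⁻¹ y} M` of the inverse of the chart `e` at `y`. -/
def chartSymmDeriv (e : OpenPartialHomeomorph M (EuclideanSpace ℝ (Fin n)))
    (y : EuclideanSpace ℝ (Fin n)) :
    EuclideanSpace ℝ (Fin n) →L[ℝ] TangentSpace (𝓡 n) (e.symm y) :=
  mfderiv 𝓘(ℝ, EuclideanSpace ℝ (Fin n)) (𝓡 n) e.symm y

/-- Coordinate expression of a vector field: `de (X ∘ e⁻¹)`. -/
def vfieldInChart (e : OpenPartialHomeomorph M (EuclideanSpace ℝ (Fin n))) (X : VField n M)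
    (y : EuclideanSpace ℝ (Fin n)) : EuclideanSpace ℝ (Fin n) :=
  chartDeriv e (e.symm y) (X (e.symm y))

/-- Coordinate expression of a one-form: its pullback by `e⁻¹`. -/
def formInChart (e : OpenPartialHomeomorph M (EuclideanSpace ℝ (Fin n))) (θ : OneForm n M)
    (y : EuclideanSpace ℝ (Fin n)) : EuclideanSpace ℝ (Fin n) →L[ℝ] ℝ :=
  (θ (e.symm y)).comp (chartSymmDeriv e y)

/-- Coordinate expression of a two-tensor field: its pullback by `e⁻¹`. -/
def tensorInChart (e : OpenPartialHomeomorph M (EuclideanSpace ℝ (Fin n))) (φ : TwoTensor n M)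
    (y : EuclideanSpace ℝ (Fin n)) :
    EuclideanSpace ℝ (Fin n) →L[ℝ] EuclideanSpace ℝ (Fin n) →L[ℝ] ℝ :=
  pullForm (φ (e.symm y)) (chartSymmDeriv e y)

variable [IsManifold (𝓡 n) ∞ M] (g : Metric n M)

/-! ### Pointwise metric operations -/

/-- The vector field `θ^♯` with `g(θ^♯, ·) = θ`. -/
def sharp (θ : OneForm n M) : VField n M := fun x => (g.inner x).inverse (θ x)

/-- The trace `tr_g φ = g^{ij} φ_{ij}`. -/
def traceG (φ : TwoTensor n M) (x : M) : ℝ :=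
  LinearMap.trace ℝ (TangentSpace (𝓡 n) x) ((g.inner x).inverse.comp (φ x)).toLinearMap

/-- The inner product `g(φ, ψ) = g^{ik} g^{jl} φ_{ij} ψ_{kl}` of symmetric two-tensors, the
trace of the composition of the associated endomorphisms. -/
def innerG (φ ψ : TwoTensor n M) (x : M) : ℝ :=
  LinearMap.trace ℝ (TangentSpace (𝓡 n) x)
    (((g.inner x).inverse.comp (ψ x)).comp ((g.inner x).inverse.comp (φ x))).toLinearMap

/-! ### Differential operators and curvature

The value at `x` is computed in the preferred chart at `x`. -/

/-- The Lie derivative `L_X g` of the metric. -/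
def lieMetric (X : VField n M) : TwoTensor n M := fun x =>
  let e := chartAt (EuclideanSpace ℝ (Fin n)) x
  pullForm (coordLie (tensorInChart e g.inner) (vfieldInChart e X) (e x)) (chartDeriv e x)

/-- The codifferential `δθ = -tr_g ∇θ` of a one-form. -/
def codiff (θ : OneForm n M) (x : M) : ℝ :=
  let e := chartAt (EuclideanSpace ℝ (Fin n)) x
  coordCodiff (tensorInChart e g.inner) (formInChart e θ) (e x)

/-- The value `(δφ)(w)` at a tangent vector `w` of the divergence `δφ = -tr_g ∇φ` of a symmetric
two-tensor. -/
def divergence₂ (φ : TwoTensor n M) (x : M) (w : TangentSpace (𝓡 n) x) : ℝ :=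
  let e := chartAt (EuclideanSpace ℝ (Fin n)) x
  coordDiv₂ (tensorInChart e g.inner) (tensorInChart e φ) (e x) (chartDeriv e x w)

/-- The Ricci tensor. -/
def ricci : TwoTensor n M := fun x =>
  let e := chartAt (EuclideanSpace ℝ (Fin n)) x
  pullForm (coordRicci (tensorInChart e g.inner) (e x)) (chartDeriv e x)

/-- The scalar curvature `s = tr_g Ric`. -/
def scalarCurv (x : M) : ℝ := traceG g (ricci g) x

/-- The traceless Ricci tensor `Ric₀ = Ric - (s / n) g`. -/
def ricci₀ : TwoTensor n M := fun x => ricci g x - (scalarCurv g x / n) • g.inner x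

/-- The operator `δ^*θ = ½ L_ξ g`, `ξ = θ^♯`. -/
def deltaStar (θ : OneForm n M) : TwoTensor n M := fun x =>
  (1 / 2 : ℝ) • lieMetric g (sharp g θ) x

/-- The Cauchy-Ahlfors operator `Sθ = δ^*θ + (1 / n) (δθ) g`. -/
def cauchyAhlfors (θ : OneForm n M) : TwoTensor n M := fun x =>
  deltaStar g θ x + ((1 / n : ℝ) * codiff g θ x) • g.inner x

/-- The Lie derivative `L_X f = df(X)` of a function. -/
def lieFun (X : VField n M) (f : M → ℝ) (x : M) : ℝ :=
  mfderiv (𝓡 n) 𝓘(ℝ, ℝ) f x (X x)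

/-- `X` is a conformal Killing vector field: it is smooth and `L_X g = f g` for a smooth function
`f`. -/
def IsConformalKilling (X : VField n M) : Prop :=
  SmoothVField X ∧ ∃ f : M → ℝ, ContMDiff (𝓡 n) 𝓘(ℝ, ℝ) ∞ f ∧
    ∀ x, lieMetric g X x = f x • g.inner x

/-- `φ` is a TT-tensor: a smooth symmetric two-tensor field, traceless and divergence free. -/
structure IsTT (φ : TwoTensor n M) : Prop where
  smooth : SmoothTwoTensor φ
  symm : ∀ x u v, φ x u v = φ x v u
  traceless : ∀ x, traceG g φ x = 0
  divFree : ∀ x w, divergence₂ g φ x w = 0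

/-! ### Integration -/

variable [MeasurableSpace M]

/-- The measure `√(det g_{ij}) dx¹ ⋯ dxⁿ` on the domain of the chart `e`, extended by zero. -/
def chartVolume (e : OpenPartialHomeomorph M (EuclideanSpace ℝ (Fin n))) : Measure M :=
  ((volume.restrict e.target).withDensity fun y =>
    ENNReal.ofReal (√(Matrix.det (Matrix.of fun i j : Fin n =>
      tensorInChart e g.inner y (coordVec i) (coordVec j))))).map e.symm

/-- The Riemannian volume measure: the smallest measure that dominates the measures
`√(det g_{ij}) dx¹ ⋯ dxⁿ` of the charts. As these agree on overlaps, it restricts to each of them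
on the domain of the chart (when countably many charts cover `M`, as on a compact manifold). -/
def volumeG : Measure M :=
  ⨆ x : M, chartVolume g (chartAt (EuclideanSpace ℝ (Fin n)) x)

/-- The `L²` inner product of symmetric two-tensor fields. -/
def innerL2 (φ ψ : TwoTensor n M) : ℝ := ∫ x, innerG g φ ψ x ∂(volumeG g)

end Manifold

end RiemGeom

end

/-!
The argument is integration by parts against the contracted second Bianchi identity.

Write `ξ = θ^♯`. The contracted Bianchi identity `δ Ric = -½ ds` gives
`δ Ric₀ = -((n - 2) / (2n)) ds` (`divergence_ricci₀`). The product rule (`codiff_contract`) says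
`δ(Ric₀(ξ, ·)) = (δ Ric₀)(ξ) - ⟨Ric₀, ½ L_ξ g⟩`, and since `Ric₀` is traceless the last pairing is
`⟨Ric₀, Sθ⟩`. The integral of the left hand side over the closed manifold is zero
(`integral_codiff_eq_zero`), hence `∫ ⟨Ric₀, Sθ⟩ = -((n - 2) / (2n)) ∫ L_ξ s`, which vanishes under
either hypothesis on `s`. As `Sθ` is orthogonal to `φ = Ric₀ - Sθ`, this integral is also
`∫ |Sθ|²`. So `Sθ = 0` (`cauchyAhlfors_eq_zero`), which says that `L_ξ g = -(2 / n) (δθ) g` and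
`φ = Ric₀`.

In the second part, `Ric₀` is always smooth, symmetric and traceless, and by the identity above it
is divergence free exactly if `(n - 2) ds = 0`; for `n ≥ 3` and `M` connected that means that `s` is
constant.

The differential operators are defined pointwise through the preferred chart at the point. Their
smoothness, and the fact that they are computed by any other chart, rest on the naturality of the
Christoffel symbols, the curvature and the codifferential under isometries between coordinate
domains (`IsCoordIsometry`). The volume measure is a supremum of chart measures;
`volumeG_restrict_source` identifies it on a chart domain with `√(det g) dx`, so that the divergence
theorem reduces, by a partition of unity and the formula `√g δα = -∑ ∂ᵢ(√g α^i)`, to the vanishing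
of `∫ ∂ᵢ h` for `h` with compact support.
-/

noncomputable section

namespace RiemGeom

set_option maxSynthPendingDepth 3

/-- The coordinate space `ℝⁿ`. -/
local notation:max "ℰ" n:max => EuclideanSpace ℝ (Fin n)

section CoordinateCalculus

variable {n : ℕ}

/-! ### Metrics and Christoffel symbols on a coordinate domain -/

/-- A smooth Riemannian metric on the open set `U ⊆ ℝⁿ`; the values of `G` outside `U` are
irrelevant. -/
structure IsCoordMetric (G : ℰ n → ℰ n →L[ℝ] ℰ n →L[ℝ] ℝ) (U : Set (ℰ n)) : Prop where
  isOpen : IsOpen U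
  smooth : ContDiffOn ℝ ∞ G U
  symm : ∀ y ∈ U, ∀ u v, G y u v = G y v u
  pos : ∀ y ∈ U, ∀ v, v ≠ 0 → 0 < G y v v

theorem sum_coordForm_smul (v : ℰ n) : ∑ i, coordForm i v • coordVec i = v := by
  ext j
  simp [coordForm, coordVec, Finset.sum_apply, Pi.single_apply]

theorem sum_coordForm_eq_trace (A : ℰ n →ₗ[ℝ] ℰ n) :
    ∑ i, coordForm i (A (coordVec i)) = LinearMap.trace ℝ (ℰ n) A := by
  rw [LinearMap.trace_eq_sum_inner A (EuclideanSpace.basisFun (Fin n) ℝ)]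
  simp [coordForm, coordVec, EuclideanSpace.basisFun_apply, EuclideanSpace.inner_single_left]

theorem isInvertible_of_pos {V : Type*} [NormedAddCommGroup V] [NormedSpace ℝ V]
    [FiniteDimensional ℝ V] (b : V →L[ℝ] V →L[ℝ] ℝ) (hb : ∀ v, v ≠ 0 → 0 < b v v) :
    b.IsInvertible := by
  have hinj : Function.Injective b := by
    rw [injective_iff_map_eq_zero]
    intro v hv
    by_contra hne
    have := hb v hne
    simp [hv] at this
  have hdim : Module.finrank ℝ V = Module.finrank ℝ (V →L[ℝ] ℝ) := by
    rw [← (LinearMap.toContinuousLinearMap (𝕜 := ℝ) (E := V) (F' := ℝ)).finrank_eq]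
    exact (Subspace.dual_finrank_eq (K := ℝ) (V := V)).symm
  refine ⟨(LinearEquiv.ofInjectiveOfFinrankEq b.toLinearMap hinj hdim).toContinuousLinearEquiv, ?_⟩
  ext v w
  rfl

namespace IsCoordMetric

variable {G : ℰ n → ℰ n →L[ℝ] ℰ n →L[ℝ] ℝ} {U : Set (ℰ n)} {y : ℰ n}

theorem isInvertible (hG : IsCoordMetric G U) (hy : y ∈ U) : (G y).IsInvertible :=
  isInvertible_of_pos _ (hG.pos y hy)

theorem smoothAt (hG : IsCoordMetric G U) (hy : y ∈ U) : ContDiffAt ℝ ∞ G y :=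
  hG.smooth.contDiffAt (hG.isOpen.mem_nhds hy)

theorem differentiableAt (hG : IsCoordMetric G U) (hy : y ∈ U) : DifferentiableAt ℝ G y :=
  (hG.smoothAt hy).differentiableAt (by simp)

theorem eq_of_forall (hG : IsCoordMetric G U) (hy : y ∈ U) {u v : ℰ n}
    (h : ∀ w, G y u w = G y v w) : u = v :=
  (hG.isInvertible hy).injective (by ext w; exact h w)

theorem apply_inverse (hG : IsCoordMetric G U) (hy : y ∈ U) (α : ℰ n →L[ℝ] ℝ) (w : ℰ n) :
    G y ((G y).inverse α) w = α w := by
  rw [(hG.isInvertible hy).self_apply_inverse]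

theorem smooth_inverse (hG : IsCoordMetric G U) :
    ContDiffOn ℝ ∞ (fun y => (G y).inverse) U := by
  intro y hy
  obtain ⟨e, he⟩ := hG.isInvertible hy
  have := contDiffAt_map_inverse (n := ∞) (𝕜 := ℝ) e
  rw [he] at this
  exact (this.comp y (hG.smoothAt hy)).contDiffWithinAt

end IsCoordMetric

/-- The Christoffel symbols as a bilinear map. -/
def christoffelL (G : ℰ n → ℰ n →L[ℝ] ℰ n →L[ℝ] ℝ) (y : ℰ n) : ℰ n →L[ℝ] ℰ n →L[ℝ] ℰ n :=
  (1 / 2 : ℝ) • (ContinuousLinearMap.compL ℝ (ℰ n) (ℰ n →L[ℝ] ℝ) (ℰ n) (G y).inverse).comp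
    (fderiv ℝ G y + (fderiv ℝ G y).flip
      - (ContinuousLinearMap.flipₗᵢ ℝ (ℰ n) (ℰ n) ℝ : (ℰ n →L[ℝ] ℰ n →L[ℝ] ℝ) →L[ℝ]
          ℰ n →L[ℝ] ℰ n →L[ℝ] ℝ) ∘L (fderiv ℝ G y).flip)

theorem christoffelL_apply (G : ℰ n → ℰ n →L[ℝ] ℰ n →L[ℝ] ℝ) (y u v : ℰ n) :
    christoffelL G y u v = christoffel G y u v := by
  simp [christoffelL, christoffel]

namespace IsCoordMetric

variable {G : ℰ n → ℰ n →L[ℝ] ℰ n →L[ℝ] ℝ} {U : Set (ℰ n)} {y : ℰ n}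

theorem smooth_fderiv (hG : IsCoordMetric G U) : ContDiffOn ℝ ∞ (fderiv ℝ G) U :=
  hG.smooth.fderiv_of_isOpen hG.isOpen (by simp)

theorem smooth_christoffelL (hG : IsCoordMetric G U) : ContDiffOn ℝ ∞ (christoffelL G) U := by
  have h1 := hG.smooth_fderiv
  have h2 : ContDiffOn ℝ ∞ (fun y => (fderiv ℝ G y).flip) U :=
    (ContinuousLinearMap.flipₗᵢ ℝ (ℰ n) (ℰ n) (ℰ n →L[ℝ] ℝ)).contDiff.comp_contDiffOn h1
  have h3 : ContDiffOn ℝ ∞ (fun y => ContinuousLinearMap.compL ℝ (ℰ n) (ℰ n →L[ℝ] ℝ) (ℰ n)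
      (G y).inverse) U :=
    (ContinuousLinearMap.contDiff _).comp_contDiffOn hG.smooth_inverse
  exact (h3.clm_comp ((h1.add h2).sub (contDiffOn_const.clm_comp h2))).const_smul _

theorem fderiv_symm (hG : IsCoordMetric G U) (hy : y ∈ U) (u v w : ℰ n) :
    fderiv ℝ G y u v w = fderiv ℝ G y u w v := by
  have h : (fun z => G z v w) =ᶠ[nhds y] fun z => G z w v := by
    filter_upwards [hG.isOpen.mem_nhds hy] with z hz using hG.symm z hz v w
  have hd := hG.differentiableAt hy
  have e1 : ∀ a b : ℰ n, fderiv ℝ (fun z => G z a b) y u = fderiv ℝ G y u a b := by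
    intro a b
    have := ((hd.hasFDerivAt.clm_apply (hasFDerivAt_const a y)).clm_apply
      (hasFDerivAt_const b y)).fderiv
    rw [this]; simp
  rw [← e1, ← e1, h.fderiv_eq]

/-- The Koszul formula. -/
theorem koszul (hG : IsCoordMetric G U) (hy : y ∈ U) (u v w : ℰ n) :
    2 * G y (christoffel G y u v) w
      = fderiv ℝ G y u v w + fderiv ℝ G y v u w - fderiv ℝ G y w u v := by
  simp [christoffel, hG.apply_inverse hy]

theorem christoffel_symm (hG : IsCoordMetric G U) (hy : y ∈ U) (u v : ℰ n) :
    christoffel G y u v = christoffel G y v u := by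
  refine hG.eq_of_forall hy fun w => ?_
  have h1 := hG.koszul hy u v w
  have h2 := hG.koszul hy v u w
  have := hG.fderiv_symm hy w u v
  linarith

/-- Compatibility of the Levi-Civita connection with the metric. -/
theorem fderiv_eq (hG : IsCoordMetric G U) (hy : y ∈ U) (u v w : ℰ n) :
    fderiv ℝ G y u v w = G y (christoffel G y u v) w + G y v (christoffel G y u w) := by
  have h1 := hG.koszul hy u v w
  have h2 := hG.koszul hy u w v
  rw [hG.symm y hy v]
  have e1 := hG.fderiv_symm hy u v w
  have e2 := hG.fderiv_symm hy v u w
  have e3 := hG.fderiv_symm hy w u v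
  linarith

theorem differentiableAt_christoffelL (hG : IsCoordMetric G U) (hy : y ∈ U) :
    DifferentiableAt ℝ (christoffelL G) y :=
  (hG.smooth_christoffelL.contDiffAt (hG.isOpen.mem_nhds hy)).differentiableAt (by simp)

theorem fderiv_christoffel (hG : IsCoordMetric G U) (hy : y ∈ U) (u v w : ℰ n) :
    fderiv ℝ (fun z => christoffel G z v w) y u = fderiv ℝ (christoffelL G) y u v w := by
  simp_rw [← christoffelL_apply]
  have hd := hG.differentiableAt_christoffelL hy
  have := ((hd.hasFDerivAt.clm_apply (hasFDerivAt_const v y)).clm_apply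
      (hasFDerivAt_const w y)).fderiv
  rw [this]; simp

theorem curvature_eq (hG : IsCoordMetric G U) (hy : y ∈ U) (u v w : ℰ n) :
    curvature G y u v w = fderiv ℝ (christoffelL G) y u v w - fderiv ℝ (christoffelL G) y v u w
      + christoffelL G y u (christoffelL G y v w)
      - christoffelL G y v (christoffelL G y u w) := by
  simp only [curvature, hG.fderiv_christoffel hy, christoffelL_apply]

end IsCoordMetric

/-! ### Curvature and the Bianchi identities -/

/-- The trace `∑ᵢ Φ(∂ᵢ, (dxⁱ)^♯)` of a two-tensor. -/
def coordTrace (G Φ : ℰ n → ℰ n →L[ℝ] ℰ n →L[ℝ] ℝ) (y : ℰ n) : ℝ :=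
  ∑ i, Φ y (coordVec i) ((G y).inverse (coordForm i))

/-- The covariant derivative `(∇_a R)(b, c) d` of the curvature. -/
def covDerivCurvature (G : ℰ n → ℰ n →L[ℝ] ℰ n →L[ℝ] ℝ) (y a b c d : ℰ n) : ℰ n :=
  fderiv ℝ (fun z => curvature G z b c d) y a + christoffel G y a (curvature G y b c d)
    - curvature G y (christoffel G y a b) c d - curvature G y b (christoffel G y a c) d
    - curvature G y b c (christoffel G y a d)

theorem fderiv_const_apply₂ {V W X F : Type*} [NormedAddCommGroup V] [NormedSpace ℝ V]
    [NormedAddCommGroup W] [NormedSpace ℝ W] [NormedAddCommGroup X] [NormedSpace ℝ X]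
    [NormedAddCommGroup F] [NormedSpace ℝ F] {T : V → W →L[ℝ] X →L[ℝ] F} {y : V}
    (hT : DifferentiableAt ℝ T y) (u : V) (v : W) (w : X) :
    fderiv ℝ (fun z => T z v w) y u = fderiv ℝ T y u v w := by
  have := ((hT.hasFDerivAt.clm_apply (hasFDerivAt_const v y)).clm_apply
      (hasFDerivAt_const w y)).fderiv
  rw [this]; simp

theorem coordForm_eq_sum (α : ℰ n →L[ℝ] ℝ) : α = ∑ k, α (coordVec k) • coordForm k := by
  ext v
  conv_lhs => rw [← sum_coordForm_smul v]
  simp [mul_comm]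

/-- Moving an endomorphism across a contraction. -/
theorem sum_inverse_comp (b : (ℰ n →L[ℝ] ℝ) →L[ℝ] ℰ n) (B : ℰ n →L[ℝ] ℰ n →L[ℝ] ℝ)
    (A : ℰ n →L[ℝ] ℰ n) :
    ∑ j, B (coordVec j) (b ((coordForm j).comp A)) = ∑ j, B (A (coordVec j)) (b (coordForm j)) := by
  have h1 : ∀ j, B (coordVec j) (b ((coordForm j).comp A))
      = ∑ k, coordForm j (A (coordVec k)) * B (coordVec j) (b (coordForm k)) := by
    intro j
    conv_lhs => rw [coordForm_eq_sum ((coordForm j).comp A)]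
    simp
  have h2 : ∀ k, B (A (coordVec k)) (b (coordForm k))
      = ∑ j, coordForm j (A (coordVec k)) * B (coordVec j) (b (coordForm k)) := by
    intro k
    conv_lhs => rw [← sum_coordForm_smul (A (coordVec k))]
    simp
  simp_rw [h1, h2]
  exact Finset.sum_comm

namespace IsCoordMetric

variable {G : ℰ n → ℰ n →L[ℝ] ℰ n →L[ℝ] ℝ} {U : Set (ℰ n)} {y : ℰ n}

theorem apply_inverse_right (hG : IsCoordMetric G U) (hy : y ∈ U) (α : ℰ n →L[ℝ] ℝ) (w : ℰ n) :
    G y w ((G y).inverse α) = α w := by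
  rw [hG.symm y hy, hG.apply_inverse hy]

theorem apply_inverse_symm (hG : IsCoordMetric G U) (hy : y ∈ U) (α β : ℰ n →L[ℝ] ℝ) :
    α ((G y).inverse β) = β ((G y).inverse α) := by
  rw [← hG.apply_inverse hy α, hG.apply_inverse_right hy]

/-- The inverse metric `∑ᵢ ∂ᵢ ⊗ (dxⁱ)^♯` is symmetric. -/
theorem sum_contract_symm (hG : IsCoordMetric G U) (hy : y ∈ U) (B : ℰ n →L[ℝ] ℰ n →L[ℝ] ℝ) :
    ∑ i, B ((G y).inverse (coordForm i)) (coordVec i)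
      = ∑ i, B (coordVec i) ((G y).inverse (coordForm i)) := by
  have h1 : ∀ i, B ((G y).inverse (coordForm i)) (coordVec i)
      = ∑ k, coordForm k ((G y).inverse (coordForm i)) * B (coordVec k) (coordVec i) := by
    intro i
    conv_lhs => rw [← sum_coordForm_smul ((G y).inverse (coordForm i))]
    simp
  have h2 : ∀ i, B (coordVec i) ((G y).inverse (coordForm i))
      = ∑ k, coordForm k ((G y).inverse (coordForm i)) * B (coordVec i) (coordVec k) := by
    intro i
    conv_lhs => rw [← sum_coordForm_smul ((G y).inverse (coordForm i))]
    simp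
  simp_rw [h1, h2]
  rw [Finset.sum_comm]
  refine Finset.sum_congr rfl fun i _ => Finset.sum_congr rfl fun k _ => ?_
  rw [hG.apply_inverse_symm hy]

theorem differentiableAt_inverse (hG : IsCoordMetric G U) (hy : y ∈ U) :
    DifferentiableAt ℝ (fun z => (G z).inverse) y :=
  (hG.smooth_inverse.contDiffAt (hG.isOpen.mem_nhds hy)).differentiableAt (by simp)

/-- The inverse metric is parallel: `∇_u (G⁻¹) = 0`, solved for `∂_u (G⁻¹)`. -/
theorem fderiv_inverse (hG : IsCoordMetric G U) (hy : y ∈ U) (u : ℰ n) (α : ℰ n →L[ℝ] ℝ) :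
    fderiv ℝ (fun z => (G z).inverse) y u α
      = -christoffel G y u ((G y).inverse α)
        - (G y).inverse (α.comp (christoffelL G y u)) := by
  have hI := hG.differentiableAt_inverse hy
  refine hG.eq_of_forall hy fun w => ?_
  have h1 : (fun z => G z ((G z).inverse α) w) =ᶠ[nhds y] fun _ => α w := by
    filter_upwards [hG.isOpen.mem_nhds hy] with z hz using hG.apply_inverse hz α w
  have h2 := (((hG.differentiableAt hy).hasFDerivAt.clm_apply
    (hI.hasFDerivAt.clm_apply (hasFDerivAt_const α y))).clm_apply (hasFDerivAt_const w y)).fderiv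
  rw [h1.fderiv_eq] at h2
  have h3 := congrArg (fun L => L u) h2
  simp at h3
  have h4 := hG.fderiv_eq hy u ((G y).inverse α) w
  rw [hG.apply_inverse hy] at h4
  simp [hG.apply_inverse hy, christoffelL_apply]
  linarith

/-- The trace commutes with covariant differentiation. -/
theorem fderiv_coordTrace (hG : IsCoordMetric G U) (hy : y ∈ U)
    {Φ : ℰ n → ℰ n →L[ℝ] ℰ n →L[ℝ] ℝ} (hΦ : DifferentiableAt ℝ Φ y) (u : ℰ n) :
    fderiv ℝ (coordTrace G Φ) y u
      = ∑ j, coordCovDeriv₂ G Φ y u (coordVec j) ((G y).inverse (coordForm j)) := by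
  have hI := hG.differentiableAt_inverse hy
  have hη := hG.fderiv_inverse hy u
  have hs : HasFDerivAt (coordTrace G Φ) _ y := HasFDerivAt.fun_sum (u := Finset.univ) fun j _ =>
    (hΦ.hasFDerivAt.clm_apply (hasFDerivAt_const (coordVec j) y)).clm_apply
      (hI.hasFDerivAt.clm_apply (hasFDerivAt_const (coordForm j) y))
  rw [hs.fderiv]
  simp only [coordCovDeriv₂, Finset.sum_sub_distrib]
  have h5 := sum_inverse_comp (G y).inverse (Φ y) (christoffelL G y u)
  simp only [christoffelL_apply] at h5
  simp [hη, Finset.sum_add_distrib, h5]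
  ring

theorem smooth_fderiv_christoffelL (hG : IsCoordMetric G U) :
    ContDiffOn ℝ ∞ (fderiv ℝ (christoffelL G)) U :=
  hG.smooth_christoffelL.fderiv_of_isOpen hG.isOpen (by simp)

theorem smooth_curvature (hG : IsCoordMetric G U) (u v w : ℰ n) :
    ContDiffOn ℝ ∞ (fun y => curvature G y u v w) U := by
  have h1 := hG.smooth_christoffelL
  have h2 := hG.smooth_fderiv_christoffelL
  refine ContDiffOn.congr ?_ fun y hy => hG.curvature_eq hy u v w
  have c : ∀ u : ℰ n, ContDiffOn ℝ ∞ (fun _ : ℰ n => u) U := fun u => contDiffOn_const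
  exact ((((h2.clm_apply (c u)).clm_apply (c v)).clm_apply (c w)).sub
    (((h2.clm_apply (c v)).clm_apply (c u)).clm_apply (c w))).add
    ((h1.clm_apply (c u)).clm_apply ((h1.clm_apply (c v)).clm_apply (c w))) |>.sub
    ((h1.clm_apply (c v)).clm_apply ((h1.clm_apply (c u)).clm_apply (c w)))

theorem curvature_antisymm (hG : IsCoordMetric G U) (hy : y ∈ U) (u v w : ℰ n) :
    curvature G y u v w = -curvature G y v u w := by
  simp only [hG.curvature_eq hy]; abel

theorem fderiv_christoffelL_symm (hG : IsCoordMetric G U) (hy : y ∈ U) (u v w : ℰ n) :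
    fderiv ℝ (christoffelL G) y u v w = fderiv ℝ (christoffelL G) y u w v := by
  have hd := hG.differentiableAt_christoffelL hy
  rw [← fderiv_const_apply₂ hd, ← fderiv_const_apply₂ hd]
  have : (fun z => christoffelL G z v w) =ᶠ[nhds y] fun z => christoffelL G z w v := by
    filter_upwards [hG.isOpen.mem_nhds hy] with z hz
    simp only [christoffelL_apply, hG.christoffel_symm hz v w]
  rw [this.fderiv_eq]

theorem christoffelL_symm (hG : IsCoordMetric G U) (hy : y ∈ U) (u v : ℰ n) :
    christoffelL G y u v = christoffelL G y v u := by
  simp only [christoffelL_apply, hG.christoffel_symm hy u v]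

/-- The first Bianchi identity. -/
theorem curvature_cyclic (hG : IsCoordMetric G U) (hy : y ∈ U) (a b c : ℰ n) :
    curvature G y a b c + curvature G y b c a + curvature G y c a b = 0 := by
  simp only [hG.curvature_eq hy]
  rw [hG.fderiv_christoffelL_symm hy a b c, hG.fderiv_christoffelL_symm hy b c a,
    hG.fderiv_christoffelL_symm hy c a b, hG.christoffelL_symm hy a b, hG.christoffelL_symm hy b c,
    hG.christoffelL_symm hy c a]
  abel

/-- The curvature endomorphisms `R(a, b)` are skew-adjoint. -/
theorem curvature_skew (hG : IsCoordMetric G U) (hy : y ∈ U) (a b c d : ℰ n) :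
    G y (curvature G y a b c) d = -G y (curvature G y a b d) c := by
  have hd := hG.differentiableAt_christoffelL hy
  have hsymm : IsSymmSndFDerivAt ℝ G y :=
    (hG.smoothAt hy).isSymmSndFDerivAt (by
      rw [minSmoothness_of_isRCLikeNormedField]
      exact WithTop.coe_le_coe.2 (le_top : (2 : ℕ∞) ≤ ⊤))
  have hdG : DifferentiableAt ℝ (fderiv ℝ G) y :=
    (hG.smooth_fderiv.contDiffAt (hG.isOpen.mem_nhds hy)).differentiableAt (by simp)
  have key : ∀ a b, fderiv ℝ (fderiv ℝ G) y a b c d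
      = G y (christoffelL G y a (christoffelL G y b c)) d
        + G y (christoffelL G y b c) (christoffelL G y a d)
        + G y (fderiv ℝ (christoffelL G) y a b c) d
        + (G y (christoffelL G y a c) (christoffelL G y b d)
        + G y c (christoffelL G y a (christoffelL G y b d))
        + G y c (fderiv ℝ (christoffelL G) y a b d)) := by
    intro a b
    have h1 : (fun z => fderiv ℝ G z b c d) =ᶠ[nhds y]
        fun z => G z (christoffelL G z b c) d + G z c (christoffelL G z b d) := by
      filter_upwards [hG.isOpen.mem_nhds hy] with z hz
      simp only [christoffelL_apply, hG.fderiv_eq hz b c d]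
    have h2 : fderiv ℝ (fun z => fderiv ℝ G z b c d) y a = fderiv ℝ (fderiv ℝ G) y a b c d := by
      have := (((hdG.hasFDerivAt.clm_apply (hasFDerivAt_const b y)).clm_apply
        (hasFDerivAt_const c y)).clm_apply (hasFDerivAt_const d y)).fderiv
      rw [this]; simp
    have hΓ : ∀ e, HasFDerivAt (fun z => christoffelL G z b e) _ y := fun e =>
      (hd.hasFDerivAt.clm_apply (hasFDerivAt_const b y)).clm_apply (hasFDerivAt_const e y)
    have hGd := (hG.differentiableAt hy).hasFDerivAt
    have h3 := ((hGd.clm_apply (hΓ c)).clm_apply (hasFDerivAt_const d y)).add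
      ((hGd.clm_apply (hasFDerivAt_const c y)).clm_apply (hΓ d))
    have h4 := h3.fderiv
    rw [← h2, h1.fderiv_eq]
    erw [h4]
    have e1 := hG.fderiv_eq hy a (christoffelL G y b c) d
    have e2 := hG.fderiv_eq hy a c (christoffelL G y b d)
    simp only [← christoffelL_apply] at e1 e2
    simp [e1, e2]
    ring
  have hs := congrArg (fun L => L c d) (hsymm a b)
  simp only [key] at hs
  simp only [hG.curvature_eq hy, map_add, map_sub, add_apply,
    sub_apply, hG.symm y hy _ c] at hs ⊢
  linarith

end IsCoordMetric

namespace IsCoordMetric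

variable {G : ℰ n → ℰ n →L[ℝ] ℰ n →L[ℝ] ℝ} {U : Set (ℰ n)} {y : ℰ n}

theorem fderiv_curvature (hG : IsCoordMetric G U) (hy : y ∈ U) (a b c d : ℰ n) :
    fderiv ℝ (fun z => curvature G z b c d) y a
      = fderiv ℝ (fderiv ℝ (christoffelL G)) y a b c d
        - fderiv ℝ (fderiv ℝ (christoffelL G)) y a c b d
        + (fderiv ℝ (christoffelL G) y a b (christoffelL G y c d)
          + christoffelL G y b (fderiv ℝ (christoffelL G) y a c d))
        - (fderiv ℝ (christoffelL G) y a c (christoffelL G y b d)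
          + christoffelL G y c (fderiv ℝ (christoffelL G) y a b d)) := by
  have h1 : (fun z => curvature G z b c d) =ᶠ[nhds y] fun z =>
      fderiv ℝ (christoffelL G) z b c d - fderiv ℝ (christoffelL G) z c b d
      + christoffelL G z b (christoffelL G z c d) - christoffelL G z c (christoffelL G z b d) := by
    filter_upwards [hG.isOpen.mem_nhds hy] with z hz using hG.curvature_eq hz b c d
  have hΓ := (hG.differentiableAt_christoffelL hy).hasFDerivAt
  have hD := ((hG.smooth_fderiv_christoffelL.contDiffAt
    (hG.isOpen.mem_nhds hy)).differentiableAt (by simp)).hasFDerivAt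
  have c1 : ∀ e : ℰ n, HasFDerivAt (fun _ : ℰ n => e) (0 : ℰ n →L[ℝ] ℰ n) y :=
    fun e => hasFDerivAt_const e y
  have h2 := (((((hD.clm_apply (c1 b)).clm_apply (c1 c)).clm_apply (c1 d)).fun_sub
    (((hD.clm_apply (c1 c)).clm_apply (c1 b)).clm_apply (c1 d))).fun_add
    ((hΓ.clm_apply (c1 b)).clm_apply ((hΓ.clm_apply (c1 c)).clm_apply (c1 d)))).fun_sub
    ((hΓ.clm_apply (c1 c)).clm_apply ((hΓ.clm_apply (c1 b)).clm_apply (c1 d)))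
  rw [h1.fderiv_eq, h2.fderiv]
  simp
  abel

set_option maxHeartbeats 1000000 in
/-- The second Bianchi identity. -/
theorem covDerivCurvature_cyclic (hG : IsCoordMetric G U) (hy : y ∈ U) (a b c d : ℰ n) :
    covDerivCurvature G y a b c d + covDerivCurvature G y b c a d
      + covDerivCurvature G y c a b d = 0 := by
  have hsymm : IsSymmSndFDerivAt ℝ (christoffelL G) y :=
    (hG.smooth_christoffelL.contDiffAt
      (hG.isOpen.mem_nhds hy)).isSymmSndFDerivAt (by
        rw [minSmoothness_of_isRCLikeNormedField]
        exact WithTop.coe_le_coe.2 (le_top : (2 : ℕ∞) ≤ ⊤))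
  have hs : ∀ a b, fderiv ℝ (fderiv ℝ (christoffelL G)) y a b
    = fderiv ℝ (fderiv ℝ (christoffelL G)) y b a := fun a b => hsymm a b
  simp only [covDerivCurvature, hG.fderiv_curvature hy, hG.curvature_eq hy, ← christoffelL_apply,
    map_add, map_sub]
  rw [hs b a, hs c a, hs c b, hG.christoffelL_symm hy b a, hG.christoffelL_symm hy c a,
    hG.christoffelL_symm hy c b]
  generalize fderiv ℝ (fderiv ℝ (christoffelL G)) y = D₂
  generalize fderiv ℝ (christoffelL G) y = D
  generalize christoffelL G y = Γ
  abel

theorem covDerivCurvature_antisymm (hG : IsCoordMetric G U) (hy : y ∈ U) (a b c d : ℰ n) :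
    covDerivCurvature G y a b c d = -covDerivCurvature G y a c b d := by
  simp only [covDerivCurvature, hG.fderiv_curvature hy, hG.curvature_eq hy, ← christoffelL_apply,
    map_add, map_sub]
  abel

theorem covDerivCurvature_skew (hG : IsCoordMetric G U) (hy : y ∈ U) (a b c d e : ℰ n) :
    G y (covDerivCurvature G y a b c d) e = -G y (covDerivCurvature G y a b c e) d := by
  have hGd := (hG.differentiableAt hy).hasFDerivAt
  have hR : ∀ d, DifferentiableAt ℝ (fun z => curvature G z b c d) y := fun d =>
    ((hG.smooth_curvature b c d).contDiffAt (hG.isOpen.mem_nhds hy)).differentiableAt (by simp)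
  have key : ∀ d e, fderiv ℝ (fun z => G z (curvature G z b c d) e) y a
      = G y (christoffel G y a (curvature G y b c d)) e
        + G y (curvature G y b c d) (christoffel G y a e)
        + G y (fderiv ℝ (fun z => curvature G z b c d) y a) e := by
    intro d e
    have h := ((hGd.clm_apply (hR d).hasFDerivAt).clm_apply (hasFDerivAt_const e y)).fderiv
    rw [h, ← hG.fderiv_eq hy]
    simp
    ring
  have h1 : (fun z => G z (curvature G z b c d) e) =ᶠ[nhds y]
      fun z => -G z (curvature G z b c e) d := by
    filter_upwards [hG.isOpen.mem_nhds hy] with z hz using hG.curvature_skew hz b c d e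
  have h2 := congrArg (fun L => L a) (h1.fderiv_eq (𝕜 := ℝ))
  simp only [fderiv_fun_neg, neg_apply, key] at h2
  simp only [covDerivCurvature, map_add, map_sub, add_apply, sub_apply]
  have e1 := hG.curvature_skew hy (christoffel G y a b) c d e
  have e2 := hG.curvature_skew hy b (christoffel G y a c) d e
  have e3 := hG.curvature_skew hy b c (christoffel G y a d) e
  have e4 := hG.curvature_skew hy b c (christoffel G y a e) d
  linarith

/-- The linear map `u ↦ R(u, v) w`, whose trace is `Ric(v, w)`. -/
theorem exists_curvature_linear (hG : IsCoordMetric G U) (hy : y ∈ U) (v w : ℰ n) :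
    ∃ A : ℰ n →L[ℝ] ℰ n, ∀ u, curvature G y u v w = A u := by
  refine ⟨LinearMap.toContinuousLinearMap
    { toFun := fun u => curvature G y u v w, map_add' := ?_, map_smul' := ?_ }, fun u => rfl⟩
  · intro u u'
    simp only [hG.curvature_eq hy, map_add, add_apply]
    abel
  · intro r u
    simp only [hG.curvature_eq hy, map_smul, smul_apply, RingHom.id_apply]
    module

/-- On the domain of the metric the curvature is linear in each argument, so that the Ricci tensor
defined by its components is the trace of the curvature. -/
theorem coordRicci_apply (hG : IsCoordMetric G U) (hy : y ∈ U) (v w : ℰ n) :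
    coordRicci G y v w = coordRicciFun G y v w := by
  let B : ℰ n →ₗ[ℝ] ℰ n →ₗ[ℝ] ℝ := LinearMap.mk₂ ℝ (coordRicciFun G y)
    (fun u u' w => by
      simp only [coordRicciFun, ← Finset.sum_add_distrib]
      refine Finset.sum_congr rfl fun i _ => ?_
      rw [← map_add]
      refine congrArg _ ?_
      simp only [hG.curvature_eq hy, map_add, add_apply]; abel)
    (fun r u w => by
      simp only [coordRicciFun]
      rw [Finset.smul_sum]
      refine Finset.sum_congr rfl fun i _ => ?_
      rw [← map_smul]
      refine congrArg _ ?_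
      simp only [hG.curvature_eq hy, map_smul, smul_apply]; module)
    (fun u w w' => by
      simp only [coordRicciFun, ← Finset.sum_add_distrib]
      refine Finset.sum_congr rfl fun i _ => ?_
      rw [← map_add]
      refine congrArg _ ?_
      simp only [hG.curvature_eq hy, map_add]; abel)
    (fun r u w => by
      simp only [coordRicciFun]
      rw [Finset.smul_sum]
      refine Finset.sum_congr rfl fun i _ => ?_
      rw [← map_smul]
      refine congrArg _ ?_
      simp only [hG.curvature_eq hy, map_smul]; module)
  have hB : ∀ v w, coordRicciFun G y v w = B v w := fun v w => rfl
  rw [hB v w]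
  conv_rhs => rw [← sum_coordForm_smul v, ← sum_coordForm_smul w]
  simp only [coordRicci, hB, map_sum, map_smul, sum_apply, smul_apply, LinearMap.sum_apply,
    LinearMap.smul_apply, ContinuousLinearMap.smulRight_apply, smul_eq_mul, Finset.mul_sum]
  rw [Finset.sum_comm]
  refine Finset.sum_congr rfl fun i _ => Finset.sum_congr rfl fun j _ => ?_
  ring

theorem smooth_coordRicci (hG : IsCoordMetric G U) : ContDiffOn ℝ ∞ (coordRicci G) U := by
  refine ContDiffOn.sum fun i _ => ContDiffOn.sum fun j _ => ?_
  refine ContDiffOn.fun_smul ?_ contDiffOn_const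
  exact ContDiffOn.sum fun k _ =>
    (coordForm k).contDiff.comp_contDiffOn (hG.smooth_curvature _ _ _)

/-- The endomorphisms `R(v, w)` are traceless, being skew-adjoint. -/
theorem trace_curvature (hG : IsCoordMetric G U) (hy : y ∈ U) (v w : ℰ n) :
    ∑ i, coordForm i (curvature G y v w (coordVec i)) = 0 := by
  have h1 : ∀ i, coordForm i (curvature G y v w (coordVec i))
      = -G y (curvature G y v w ((G y).inverse (coordForm i))) (coordVec i) := by
    intro i
    rw [← hG.curvature_skew hy, hG.apply_inverse_right hy]
  let A : ℰ n →L[ℝ] ℰ n := fderiv ℝ (christoffelL G) y v w - fderiv ℝ (christoffelL G) y w v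
      + (christoffelL G y v).comp (christoffelL G y w)
      - (christoffelL G y w).comp (christoffelL G y v)
  have hA : ∀ u, curvature G y v w u = A u := fun u => hG.curvature_eq hy v w u
  have h2 := hG.sum_contract_symm hy ((G y).comp A)
  have h3 : ∀ i, coordForm i (A (coordVec i))
      = G y (A (coordVec i)) ((G y).inverse (coordForm i)) :=
    fun i => (hG.apply_inverse_right hy _ _).symm
  simp only [ContinuousLinearMap.comp_apply] at h2
  have h4 := Finset.sum_congr rfl fun i (_ : i ∈ Finset.univ) => h1 i
  simp only [hA, Finset.sum_neg_distrib] at h4 ⊢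
  rw [h2] at h4
  simp only [← h3] at h4
  linarith

theorem coordRicci_symm (hG : IsCoordMetric G U) (hy : y ∈ U) (v w : ℰ n) :
    coordRicci G y v w = coordRicci G y w v := by
  rw [hG.coordRicci_apply hy, hG.coordRicci_apply hy, ← sub_eq_zero, coordRicciFun, coordRicciFun,
    ← Finset.sum_sub_distrib, ← neg_eq_zero, ← hG.trace_curvature hy v w, ← Finset.sum_neg_distrib]
  refine Finset.sum_congr rfl fun i _ => ?_
  rw [← map_sub, ← map_neg]
  refine congrArg _ ?_
  have hc := hG.curvature_cyclic hy (coordVec i) v w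
  rw [hG.curvature_antisymm hy w (coordVec i) v] at hc
  rw [← sub_eq_zero, ← neg_eq_zero, ← hc]
  abel

/-- Contraction commutes with covariant differentiation. -/
theorem coordCovDeriv₂_coordRicci (hG : IsCoordMetric G U) (hy : y ∈ U) (u v w : ℰ n) :
    coordCovDeriv₂ G (coordRicci G) y u v w
      = ∑ i, coordForm i (covDerivCurvature G y u (coordVec i) v w) := by
  have hd : DifferentiableAt ℝ (coordRicci G) y :=
    (hG.smooth_coordRicci.contDiffAt (hG.isOpen.mem_nhds hy)).differentiableAt (by simp)
  have hR : ∀ a b c, DifferentiableAt ℝ (fun z => curvature G z a b c) y := fun a b c =>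
    ((hG.smooth_curvature a b c).contDiffAt (hG.isOpen.mem_nhds hy)).differentiableAt (by simp)
  have h1 : (fun z => coordRicci G z v w) =ᶠ[nhds y]
      fun z => ∑ i, coordForm i (curvature G z (coordVec i) v w) := by
    filter_upwards [hG.isOpen.mem_nhds hy] with z hz using hG.coordRicci_apply hz v w
  have h2 : HasFDerivAt (fun z => ∑ i, coordForm i (curvature G z (coordVec i) v w)) _ y :=
    HasFDerivAt.fun_sum (u := Finset.univ) fun i _ =>
      (coordForm i).hasFDerivAt.comp y (hR (coordVec i) v w).hasFDerivAt
  obtain ⟨A, hA⟩ := hG.exists_curvature_linear hy v w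
  have h3 : ∑ i, coordForm i (christoffel G y u (curvature G y (coordVec i) v w))
      = ∑ i, coordForm i (curvature G y (christoffel G y u (coordVec i)) v w) := by
    simp only [hA, ← christoffelL_apply]
    have := LinearMap.trace_mul_comm ℝ (christoffelL G y u).toLinearMap A.toLinearMap
    rw [← sum_coordForm_eq_trace, ← sum_coordForm_eq_trace] at this
    exact this
  rw [coordCovDeriv₂, ← fderiv_const_apply₂ hd, h1.fderiv_eq, h2.fderiv, hG.coordRicci_apply hy,
    hG.coordRicci_apply hy]
  simp only [covDerivCurvature, map_sub, map_add, Finset.sum_sub_distrib, Finset.sum_add_distrib,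
    h3, coordRicciFun]
  simp

/-- The contracted second Bianchi identity `δ Ric = -½ ds`. -/
theorem coordDiv₂_coordRicci (hG : IsCoordMetric G U) (hy : y ∈ U) (w : ℰ n) :
    coordDiv₂ G (coordRicci G) y w
      = -(1 / 2) * fderiv ℝ (coordTrace G (coordRicci G)) y w := by
  have hd : DifferentiableAt ℝ (coordRicci G) y :=
    (hG.smooth_coordRicci.contDiffAt (hG.isOpen.mem_nhds hy)).differentiableAt (by simp)
  rw [hG.fderiv_coordTrace hy hd, coordDiv₂]
  simp only [hG.coordCovDeriv₂_coordRicci hy]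
  set e : Fin n → ℰ n := fun i => (G y).inverse (coordForm i) with he
  -- Contract the second Bianchi identity for `(∂_w, ∂ᵢ, ∂ⱼ)` twice.
  have hc : ∀ i j, coordForm i (covDerivCurvature G y w (coordVec i) (coordVec j) (e j))
      + coordForm i (covDerivCurvature G y (coordVec i) (coordVec j) w (e j))
      - coordForm i (covDerivCurvature G y (coordVec j) (coordVec i) w (e j)) = 0 := by
    intro i j
    have := congrArg (coordForm i)
      (hG.covDerivCurvature_cyclic hy w (coordVec i) (coordVec j) (e j))
    rw [hG.covDerivCurvature_antisymm hy _ w] at this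
    simpa [sub_eq_add_neg] using this
  have hsk : ∀ i j, coordForm i (covDerivCurvature G y (coordVec i) (coordVec j) w (e j))
      = -coordForm j (covDerivCurvature G y (coordVec i) (coordVec j) w (e i)) := by
    intro i j
    rw [← hG.apply_inverse_right hy (coordForm i), hG.covDerivCurvature_skew hy,
      hG.apply_inverse_right hy]
  have hR : ∀ u v w, ∑ i, coordForm i (covDerivCurvature G y u (coordVec i) v w)
      = ∑ i, coordForm i (covDerivCurvature G y u (coordVec i) w v) := by
    intro u v w
    rw [← hG.coordCovDeriv₂_coordRicci hy, ← hG.coordCovDeriv₂_coordRicci hy]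
    have : (fun z => coordRicci G z v w) =ᶠ[nhds y] fun z => coordRicci G z w v := by
      filter_upwards [hG.isOpen.mem_nhds hy] with z hz using hG.coordRicci_symm hz v w
    simp only [coordCovDeriv₂, ← fderiv_const_apply₂ hd, this.fderiv_eq, hG.coordRicci_symm hy v,
      hG.coordRicci_symm hy (christoffel G y u v)]
    ring
  have hS := Finset.sum_eq_zero fun i (_ : i ∈ Finset.univ) =>
    Finset.sum_eq_zero fun j (_ : j ∈ Finset.univ) => hc i j
  simp only [Finset.sum_add_distrib, Finset.sum_sub_distrib] at hS
  have e2 : ∑ i, ∑ j, coordForm i (covDerivCurvature G y (coordVec i) (coordVec j) w (e j))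
      = -∑ j, ∑ i, coordForm i (covDerivCurvature G y (coordVec j) (coordVec i) (e j) w) := by
    simp only [hsk, Finset.sum_neg_distrib]
    refine congrArg _ (Finset.sum_congr rfl fun j _ => ?_)
    exact hR _ _ _
  have e3 : ∑ i, ∑ j, coordForm i (covDerivCurvature G y (coordVec j) (coordVec i) w (e j))
      = ∑ j, ∑ i, coordForm i (covDerivCurvature G y (coordVec j) (coordVec i) (e j) w) := by
    rw [Finset.sum_comm]
    exact Finset.sum_congr rfl fun j _ => hR _ _ _
  rw [e2, e3, Finset.sum_comm] at hS
  linarith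

/-- The divergence of `f G` is `-df` because `G` is parallel. -/
theorem coordDiv₂_smul_metric (hG : IsCoordMetric G U) (hy : y ∈ U) {f : ℰ n → ℝ}
    (hf : DifferentiableAt ℝ f y) (w : ℰ n) :
    coordDiv₂ G (fun z => f z • G z) y w = -fderiv ℝ f y w := by
  have h1 : ∀ u v, coordCovDeriv₂ G (fun z => f z • G z) y u v w = fderiv ℝ f y u * G y v w := by
    intro u v
    rw [coordCovDeriv₂, fderiv_fun_smul hf (hG.differentiableAt hy)]
    simp [hG.fderiv_eq hy]
    ring
  simp only [coordDiv₂, h1, hG.apply_inverse hy]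
  conv_rhs => rw [← sum_coordForm_smul w]
  simp [mul_comm]

end IsCoordMetric

theorem coordDiv₂_sub (G : ℰ n → ℰ n →L[ℝ] ℰ n →L[ℝ] ℝ) {y : ℰ n}
    {Φ Ψ : ℰ n → ℰ n →L[ℝ] ℰ n →L[ℝ] ℝ} (hΦ : DifferentiableAt ℝ Φ y)
    (hΨ : DifferentiableAt ℝ Ψ y) (w : ℰ n) :
    coordDiv₂ G (fun z => Φ z - Ψ z) y w = coordDiv₂ G Φ y w - coordDiv₂ G Ψ y w := by
  simp only [coordDiv₂, coordCovDeriv₂, fderiv_fun_sub hΦ hΨ, sub_apply, Finset.sum_sub_distrib]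
  ring

theorem coordCodiff_congr (G : ℰ n → ℰ n →L[ℝ] ℰ n →L[ℝ] ℝ) {α β : ℰ n → ℰ n →L[ℝ] ℝ} {y : ℰ n}
    (h : α =ᶠ[nhds y] β) : coordCodiff G α y = coordCodiff G β y := by
  simp only [coordCodiff, h.fderiv_eq, h.eq_of_nhds]

theorem coordDiv₂_congr (G : ℰ n → ℰ n →L[ℝ] ℰ n →L[ℝ] ℝ) {Φ Ψ : ℰ n → ℰ n →L[ℝ] ℰ n →L[ℝ] ℝ}
    {y : ℰ n} (h : Φ =ᶠ[nhds y] Ψ) (w : ℰ n) : coordDiv₂ G Φ y w = coordDiv₂ G Ψ y w := by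
  simp only [coordDiv₂, coordCovDeriv₂, h.fderiv_eq, h.eq_of_nhds]

/-! ### Naturality under isometries -/

/-- A smooth map `ψ` pulling the metric `G` on `U` back to the metric `G'` on `U'`. -/
structure IsCoordIsometry (ψ : ℰ n → ℰ n) (G' : ℰ n → ℰ n →L[ℝ] ℰ n →L[ℝ] ℝ) (U' : Set (ℰ n))
    (G : ℰ n → ℰ n →L[ℝ] ℰ n →L[ℝ] ℝ) (U : Set (ℰ n)) : Prop where
  source : IsCoordMetric G' U'
  target : IsCoordMetric G U
  smooth : ContDiffOn ℝ ∞ ψ U'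
  mapsTo : Set.MapsTo ψ U' U
  pull : ∀ y ∈ U', G' y = pullForm (G (ψ y)) (fderiv ℝ ψ y)

theorem trace_eq_of_conj {V W : Type*} [AddCommGroup V] [Module ℝ V] [AddCommGroup W] [Module ℝ W]
    (A : V ≃ₗ[ℝ] W) (B' : V →ₗ[ℝ] V) (B : W →ₗ[ℝ] W)
    (h : ∀ v, A (B' v) = B (A v)) : LinearMap.trace ℝ V B' = LinearMap.trace ℝ W B := by
  rw [← LinearMap.trace_conj' B' A]
  congr 1
  ext w
  simp [LinearEquiv.conj_apply, h]

section TraceForm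

variable {V W : Type*} [TopologicalSpace V] [AddCommGroup V] [Module ℝ V]
    [IsTopologicalAddGroup V] [ContinuousSMul ℝ V]
    [TopologicalSpace W] [AddCommGroup W] [Module ℝ W]
    [IsTopologicalAddGroup W] [ContinuousSMul ℝ W]

theorem inverse_pullForm (b : W →L[ℝ] W →L[ℝ] ℝ) (hb : b.IsInvertible) (A : V ≃L[ℝ] W)
    (α : V →L[ℝ] ℝ) :
    (pullForm b (A : V →L[ℝ] W)).inverse α
      = A.symm (b.inverse (α.comp (A.symm : W →L[ℝ] V))) := by
  have h : (pullForm b (A : V →L[ℝ] W)).inverse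
      = ((A.symm : W →L[ℝ] V).comp b.inverse).comp
        (ContinuousLinearMap.precomp ℝ (A.symm : W →L[ℝ] V)) := by
    apply ContinuousLinearMap.inverse_eq
    · ext α v
      simp [hb.self_apply_inverse]
    · ext v
      have : (ContinuousLinearMap.precomp ℝ (A.symm : W →L[ℝ] V)) ((pullForm b (A : V →L[ℝ] W)) v)
          = b (A v) := by
        ext w; simp
      simp only [ContinuousLinearMap.comp_apply, this, hb.inverse_apply_self]
      simp
  rw [h]; rfl

theorem inverse_pullForm_comp (b φ : W →L[ℝ] W →L[ℝ] ℝ) (hb : b.IsInvertible) (A : V ≃L[ℝ] W)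
    (v : V) :
    A ((pullForm b (A : V →L[ℝ] W)).inverse (pullForm φ (A : V →L[ℝ] W) v))
      = b.inverse (φ (A v)) := by
  rw [inverse_pullForm b hb, ContinuousLinearEquiv.apply_symm_apply]
  congr 1
  ext w
  simp

theorem trace_pullForm (b φ : W →L[ℝ] W →L[ℝ] ℝ) (hb : b.IsInvertible) (A : V ≃L[ℝ] W) :
    LinearMap.trace ℝ V ((pullForm b (A : V →L[ℝ] W)).inverse.comp
        (pullForm φ (A : V →L[ℝ] W))).toLinearMap
      = LinearMap.trace ℝ W (b.inverse.comp φ).toLinearMap :=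
  trace_eq_of_conj A.toLinearEquiv _ _ fun v => inverse_pullForm_comp b φ hb A v

theorem trace_pullForm₂ (b φ ψ : W →L[ℝ] W →L[ℝ] ℝ) (hb : b.IsInvertible) (A : V ≃L[ℝ] W) :
    LinearMap.trace ℝ V (((pullForm b (A : V →L[ℝ] W)).inverse.comp
        (pullForm ψ (A : V →L[ℝ] W))).comp ((pullForm b (A : V →L[ℝ] W)).inverse.comp
        (pullForm φ (A : V →L[ℝ] W)))).toLinearMap
      = LinearMap.trace ℝ W ((b.inverse.comp ψ).comp (b.inverse.comp φ)).toLinearMap :=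
  trace_eq_of_conj A.toLinearEquiv _ _ fun v => by
    refine (inverse_pullForm_comp b ψ hb A _).trans ?_
    exact congrArg (fun x => b.inverse (ψ x)) (inverse_pullForm_comp b φ hb A v)

end TraceForm

namespace IsCoordMetric

variable {G : ℰ n → ℰ n →L[ℝ] ℰ n →L[ℝ] ℝ} {U : Set (ℰ n)} {y : ℰ n}

theorem sum_contract_eq_trace (hG : IsCoordMetric G U) (hy : y ∈ U)
    (B : ℰ n →L[ℝ] ℰ n →L[ℝ] ℝ) :
    ∑ i, B (coordVec i) ((G y).inverse (coordForm i))
      = LinearMap.trace ℝ (ℰ n) ((G y).inverse.comp B).toLinearMap := by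
  rw [← sum_coordForm_eq_trace]
  exact Finset.sum_congr rfl fun i _ => (hG.apply_inverse_symm hy _ _)

end IsCoordMetric

namespace IsCoordIsometry

variable {ψ : ℰ n → ℰ n} {G' G : ℰ n → ℰ n →L[ℝ] ℰ n →L[ℝ] ℝ} {U' U : Set (ℰ n)} {y : ℰ n}

/-- An isometry is an immersion, hence its differential is invertible by equality of dimensions. -/
theorem exists_equiv (h : IsCoordIsometry ψ G' U' G U) (hy : y ∈ U') :
    ∃ A : ℰ n ≃L[ℝ] ℰ n, (A : ℰ n →L[ℝ] ℰ n) = fderiv ℝ ψ y := by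
  have hinj : Function.Injective (fderiv ℝ ψ y).toLinearMap := by
    rw [injective_iff_map_eq_zero]
    intro v hv
    by_contra hne
    have := h.source.pos y hy v hne
    rw [h.pull y hy, pullForm_apply] at this
    have hv' : fderiv ℝ ψ y v = 0 := hv
    simp [hv'] at this
  exact ⟨(LinearEquiv.ofInjectiveEndo _ hinj).toContinuousLinearEquiv, by ext v; rfl⟩

theorem smoothAt (h : IsCoordIsometry ψ G' U' G U) (hy : y ∈ U') : ContDiffAt ℝ ∞ ψ y :=
  h.smooth.contDiffAt (h.source.isOpen.mem_nhds hy)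

theorem smooth_fderiv (h : IsCoordIsometry ψ G' U' G U) : ContDiffOn ℝ ∞ (fderiv ℝ ψ) U' :=
  h.smooth.fderiv_of_isOpen h.source.isOpen (by simp)

theorem differentiableAt (h : IsCoordIsometry ψ G' U' G U) (hy : y ∈ U') :
    DifferentiableAt ℝ ψ y :=
  (h.smoothAt hy).differentiableAt (by simp)

theorem differentiableAt_fderiv (h : IsCoordIsometry ψ G' U' G U) (hy : y ∈ U') :
    DifferentiableAt ℝ (fderiv ℝ ψ) y :=
  (h.smooth_fderiv.contDiffAt (h.source.isOpen.mem_nhds hy)).differentiableAt (by simp)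

theorem fderiv_fderiv_symm (h : IsCoordIsometry ψ G' U' G U) (hy : y ∈ U') (u v : ℰ n) :
    fderiv ℝ (fderiv ℝ ψ) y u v = fderiv ℝ (fderiv ℝ ψ) y v u := by
  have : IsSymmSndFDerivAt ℝ ψ y := (h.smoothAt hy).isSymmSndFDerivAt (by
        rw [minSmoothness_of_isRCLikeNormedField]
        exact WithTop.coe_le_coe.2 (le_top : (2 : ℕ∞) ≤ ⊤))
  exact this u v

/-- The transformation law of the Christoffel symbols. -/
theorem fderiv_christoffel (h : IsCoordIsometry ψ G' U' G U) (hy : y ∈ U') (u v : ℰ n) :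
    fderiv ℝ ψ y (christoffel G' y u v) = fderiv ℝ (fderiv ℝ ψ) y u v
      + christoffel G (ψ y) (fderiv ℝ ψ y u) (fderiv ℝ ψ y v) := by
  obtain ⟨A, hA⟩ := h.exists_equiv hy
  have hψy := h.mapsTo hy
  refine h.target.eq_of_forall hψy fun w => ?_
  obtain ⟨w, rfl⟩ := A.surjective w
  have hdG := h.target.differentiableAt hψy
  have hd := (h.differentiableAt hy).hasFDerivAt
  have hd2 := (h.differentiableAt_fderiv hy).hasFDerivAt
  have key : ∀ u v w, fderiv ℝ G' y u v w
      = fderiv ℝ G (ψ y) (fderiv ℝ ψ y u) (fderiv ℝ ψ y v) (fderiv ℝ ψ y w)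
        + G (ψ y) (fderiv ℝ (fderiv ℝ ψ) y u v) (fderiv ℝ ψ y w)
        + G (ψ y) (fderiv ℝ ψ y v) (fderiv ℝ (fderiv ℝ ψ) y u w) := by
    intro u v w
    rw [← fderiv_const_apply₂ (h.source.differentiableAt hy)]
    have h1 : (fun z => G' z v w) =ᶠ[nhds y]
        fun z => G (ψ z) (fderiv ℝ ψ z v) (fderiv ℝ ψ z w) := by
      filter_upwards [h.source.isOpen.mem_nhds hy] with z hz
      rw [h.pull z hz, pullForm_apply]
    have h2 := ((hdG.hasFDerivAt.comp y hd).clm_apply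
      (hd2.clm_apply (hasFDerivAt_const v y))).clm_apply (hd2.clm_apply (hasFDerivAt_const w y))
    rw [h1.fderiv_eq]
    erw [h2.fderiv]
    simp
    ring
  have hAw : A w = fderiv ℝ ψ y w := by rw [← hA]; rfl
  rw [hAw]
  have k1 := h.source.koszul hy u v w
  have k2 := h.target.koszul hψy (fderiv ℝ ψ y u) (fderiv ℝ ψ y v) (fderiv ℝ ψ y w)
  rw [h.pull y hy, pullForm_apply] at k1
  simp only [key] at k1
  rw [h.fderiv_fderiv_symm hy w u, h.fderiv_fderiv_symm hy w v, h.fderiv_fderiv_symm hy v u,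
    h.target.symm _ hψy (fderiv ℝ ψ y v), h.target.symm _ hψy (fderiv ℝ ψ y u)] at k1
  simp only [map_add, add_apply]
  linarith

/-- Naturality of the curvature. -/
theorem fderiv_curvature (h : IsCoordIsometry ψ G' U' G U) (hy : y ∈ U') (u v w : ℰ n) :
    fderiv ℝ ψ y (curvature G' y u v w)
      = curvature G (ψ y) (fderiv ℝ ψ y u) (fderiv ℝ ψ y v) (fderiv ℝ ψ y w) := by
  have hψy := h.mapsTo hy
  have hd := (h.differentiableAt hy).hasFDerivAt
  have hd2 := (h.differentiableAt_fderiv hy).hasFDerivAt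
  have hd3 := ((((h.smooth_fderiv.fderiv_of_isOpen h.source.isOpen (by simp)).contDiffAt
    (h.source.isOpen.mem_nhds hy)).differentiableAt (n := ∞) (by simp))).hasFDerivAt
  have hΓ := (h.target.differentiableAt_christoffelL hψy).hasFDerivAt
  have hΓ' := (h.source.differentiableAt_christoffelL hy).hasFDerivAt
  have c1 : ∀ e : ℰ n, HasFDerivAt (fun _ : ℰ n => e) (0 : ℰ n →L[ℝ] ℰ n) y :=
    fun e => hasFDerivAt_const e y
  have hs3 : ∀ u v, fderiv ℝ (fderiv ℝ (fderiv ℝ ψ)) y u v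
      = fderiv ℝ (fderiv ℝ (fderiv ℝ ψ)) y v u := by
    have : IsSymmSndFDerivAt ℝ (fderiv ℝ ψ) y := (h.smooth_fderiv.contDiffAt
      (h.source.isOpen.mem_nhds hy)).isSymmSndFDerivAt (by
        rw [minSmoothness_of_isRCLikeNormedField]
        exact WithTop.coe_le_coe.2 (le_top : (2 : ℕ∞) ≤ ⊤))
    exact fun u v => this u v
  -- Differentiate the transformation law of the Christoffel symbols and antisymmetrize.
  have law : ∀ z ∈ U', ∀ u v, fderiv ℝ ψ z (christoffelL G' z u v) = fderiv ℝ (fderiv ℝ ψ) z u v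
      + christoffelL G (ψ z) (fderiv ℝ ψ z u) (fderiv ℝ ψ z v) := by
    intro z hz u v
    simp only [christoffelL_apply]
    exact h.fderiv_christoffel hz u v
  have key : ∀ u v, fderiv ℝ (fderiv ℝ ψ) y u (christoffelL G' y v w)
        + fderiv ℝ ψ y (fderiv ℝ (christoffelL G') y u v w)
      = fderiv ℝ (fderiv ℝ (fderiv ℝ ψ)) y u v w
        + fderiv ℝ (christoffelL G) (ψ y) (fderiv ℝ ψ y u) (fderiv ℝ ψ y v) (fderiv ℝ ψ y w)
        + christoffelL G (ψ y) (fderiv ℝ (fderiv ℝ ψ) y u v) (fderiv ℝ ψ y w)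
        + christoffelL G (ψ y) (fderiv ℝ ψ y v) (fderiv ℝ (fderiv ℝ ψ) y u w) := by
    intro u v
    have h1 : (fun z => fderiv ℝ ψ z (christoffelL G' z v w)) =ᶠ[nhds y]
        fun z => fderiv ℝ (fderiv ℝ ψ) z v w
          + christoffelL G (ψ z) (fderiv ℝ ψ z v) (fderiv ℝ ψ z w) := by
      filter_upwards [h.source.isOpen.mem_nhds hy] with z hz using law z hz v w
    have e1 := (hd2.clm_apply ((hΓ'.clm_apply (c1 v)).clm_apply (c1 w))).fderiv
    have e2 := (((hd3.clm_apply (c1 v)).clm_apply (c1 w)).fun_add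
      (((hΓ.comp y hd).clm_apply (hd2.clm_apply (c1 v))).clm_apply
        (hd2.clm_apply (c1 w)))).fderiv
    rw [h1.fderiv_eq] at e1
    have e3 := congrArg (fun L => L u) (e1.symm.trans e2)
    simp at e3
    rw [add_comm, e3]
    abel
  have k1 := key u v
  have k2 := key v u
  simp only [h.source.curvature_eq hy, h.target.curvature_eq hψy, map_add, map_sub,
    law y hy] at k1 k2 ⊢
  rw [hs3 v u, h.fderiv_fderiv_symm hy v u] at k2
  rw [← eq_sub_iff_add_eq'] at k1 k2
  rw [k1, k2]
  abel

/-- Naturality of the Ricci tensor. -/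
theorem coordRicci_eq (h : IsCoordIsometry ψ G' U' G U) (hy : y ∈ U') :
    coordRicci G' y = pullForm (coordRicci G (ψ y)) (fderiv ℝ ψ y) := by
  ext v w
  obtain ⟨A, hA⟩ := h.exists_equiv hy
  rw [pullForm_apply, h.source.coordRicci_apply hy, h.target.coordRicci_apply (h.mapsTo hy),
    coordRicciFun, coordRicciFun]
  obtain ⟨B', hB'⟩ := h.source.exists_curvature_linear hy v w
  obtain ⟨B, hB⟩ := h.target.exists_curvature_linear (h.mapsTo hy) (fderiv ℝ ψ y v) (fderiv ℝ ψ y w)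
  simp only [hB', hB]
  have e1 := sum_coordForm_eq_trace B'.toLinearMap
  have e2 := sum_coordForm_eq_trace B.toLinearMap
  refine e1.trans (Eq.trans ?_ e2.symm)
  refine trace_eq_of_conj A.toLinearEquiv _ _ fun u => ?_
  have hAu : ∀ u, A u = fderiv ℝ ψ y u := fun u => by rw [← hA]; rfl
  change A (B' u) = B (A u)
  rw [hAu, hAu, ← hB, ← hB', h.fderiv_curvature hy]

/-- Naturality of the codifferential. -/
theorem coordCodiff_eq (h : IsCoordIsometry ψ G' U' G U) (hy : y ∈ U')
    {α' α : ℰ n → ℰ n →L[ℝ] ℝ} (hα : DifferentiableAt ℝ α (ψ y))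
    (hpull : ∀ z ∈ U', α' z = (α (ψ z)).comp (fderiv ℝ ψ z)) :
    coordCodiff G' α' y = coordCodiff G α (ψ y) := by
  obtain ⟨A, hA⟩ := h.exists_equiv hy
  have hd := (h.differentiableAt hy).hasFDerivAt
  have hd2 := (h.differentiableAt_fderiv hy).hasFDerivAt
  -- `B'` and `B` are the covariant derivatives of the two one-forms.
  let B' : ℰ n →L[ℝ] ℰ n →L[ℝ] ℝ := fderiv ℝ α' y -
    (ContinuousLinearMap.compL ℝ (ℰ n) (ℰ n) ℝ (α' y)).comp (christoffelL G' y)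
  let B : ℰ n →L[ℝ] ℰ n →L[ℝ] ℝ := fderiv ℝ α (ψ y) -
    (ContinuousLinearMap.compL ℝ (ℰ n) (ℰ n) ℝ (α (ψ y))).comp (christoffelL G (ψ y))
  have hB' : coordCodiff G' α' y = -∑ i, B' (coordVec i) ((G' y).inverse (coordForm i)) := by
    simp [coordCodiff, B', christoffelL_apply]
  have hB : coordCodiff G α (ψ y) = -∑ i, B (coordVec i) ((G (ψ y)).inverse (coordForm i)) := by
    simp [coordCodiff, B, christoffelL_apply]
  have hBB : B' = pullForm B (A : ℰ n →L[ℝ] ℰ n) := by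
    ext u v
    have h1 : α' =ᶠ[nhds y] fun z => (α (ψ z)).comp (fderiv ℝ ψ z) := by
      filter_upwards [h.source.isOpen.mem_nhds hy] with z hz using hpull z hz
    have e1 := ((hα.hasFDerivAt.comp y hd).clm_comp hd2).fderiv
    have e2 : fderiv ℝ α' y = _ := h1.fderiv_eq.trans e1
    have e3 := h.fderiv_christoffel hy u v
    simp [B', B, e2, hA, hpull y hy, christoffelL_apply, e3]
  rw [hB', hB, h.source.sum_contract_eq_trace hy, h.target.sum_contract_eq_trace (h.mapsTo hy),
    hBB, h.pull y hy, ← hA, trace_pullForm _ _ (h.target.isInvertible (h.mapsTo hy))]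

end IsCoordIsometry

/-! ### The product rule for the codifferential -/

namespace IsCoordMetric

variable {G : ℰ n → ℰ n →L[ℝ] ℰ n →L[ℝ] ℝ} {U : Set (ℰ n)} {y : ℰ n}

/-- The pairing of a symmetric two-tensor with the Lie derivative of the metric:
`½ ⟨T, L_X G⟩ = ∑ᵢ T(∇_{∂ᵢ} X, (dxⁱ)^♯)`. -/
theorem trace_coordLie (hG : IsCoordMetric G U) (hy : y ∈ U) (T : ℰ n →L[ℝ] ℰ n →L[ℝ] ℝ)
    (hT : ∀ u v, T u v = T v u) (X : ℰ n → ℰ n) :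
    LinearMap.trace ℝ (ℰ n) (((G y).inverse.comp T).comp
        ((G y).inverse.comp ((1 / 2 : ℝ) • coordLie G X y))).toLinearMap
      = ∑ i, T (fderiv ℝ X y (coordVec i) + christoffel G y (coordVec i) (X y))
          ((G y).inverse (coordForm i)) := by
  -- `N = ∇X`, so that `L_X G` corresponds to the endomorphism `N + P` with `P` the adjoint of `N`.
  let N : ℰ n →L[ℝ] ℰ n := fderiv ℝ X y + (christoffelL G y).flip (X y)
  have hN : ∀ u, fderiv ℝ X y u + christoffel G y u (X y) = N u := by
    intro u; simp [N, christoffelL_apply]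
  have hL : ∀ u v, coordLie G X y u v = G y (N u) v + G y u (N v) := by
    intro u v
    simp [coordLie, hG.fderiv_eq hy, N, christoffelL_apply, hG.christoffel_symm hy (X y)]
    ring
  let P : ℰ n →L[ℝ] ℰ n := (G y).inverse.comp ((ContinuousLinearMap.precomp ℝ N).comp (G y))
  have hP : (G y).inverse.comp (coordLie G X y) = N + P := by
    ext1 u
    refine hG.eq_of_forall hy fun w => ?_
    simp [P, hG.apply_inverse hy, hL]
  have e1 : LinearMap.trace ℝ (ℰ n) (((G y).inverse.comp T).comp N).toLinearMap
      = ∑ i, T (N (coordVec i)) ((G y).inverse (coordForm i)) := by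
    rw [← sum_coordForm_eq_trace]
    refine Finset.sum_congr rfl fun i _ => ?_
    exact hG.apply_inverse_symm hy _ _
  have e2 : LinearMap.trace ℝ (ℰ n) (((G y).inverse.comp T).comp P).toLinearMap
      = ∑ i, T (N (coordVec i)) ((G y).inverse (coordForm i)) := by
    have h1 : ∀ i, coordForm i ((((G y).inverse.comp T).comp P) (coordVec i))
        = ∑ k, G y (coordVec i) (N (coordVec k)) *
          T ((G y).inverse (coordForm k)) ((G y).inverse (coordForm i)) := by
      intro i
      have h2 : coordForm i ((((G y).inverse.comp T).comp P) (coordVec i))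
          = T (P (coordVec i)) ((G y).inverse (coordForm i)) := hG.apply_inverse_symm hy _ _
      rw [h2]
      have h3 : P (coordVec i) = ∑ k, G y (coordVec i) (N (coordVec k)) •
          (G y).inverse (coordForm k) := by
        change (G y).inverse ((G y (coordVec i)).comp N) = _
        rw [coordForm_eq_sum ((G y (coordVec i)).comp N), map_sum]
        simp
      rw [h3]
      simp
    have h4 : ∀ k, T (N (coordVec k)) ((G y).inverse (coordForm k))
        = ∑ i, G y (coordVec i) (N (coordVec k)) *
          T ((G y).inverse (coordForm k)) ((G y).inverse (coordForm i)) := by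
      intro k
      have h5 : N (coordVec k) = ∑ i, G y (coordVec i) (N (coordVec k)) •
          (G y).inverse (coordForm i) := by
        conv_lhs => rw [← (hG.isInvertible hy).inverse_apply_self (N (coordVec k)),
          coordForm_eq_sum (G y (N (coordVec k))), map_sum]
        simp [hG.symm y hy (N (coordVec k))]
      rw [hT]
      conv_lhs => rw [h5]
      simp
    rw [← sum_coordForm_eq_trace]
    simp only [ContinuousLinearMap.coe_coe, h1, h4]
    exact Finset.sum_comm
  simp only [hN]
  rw [ContinuousLinearMap.comp_smul, ContinuousLinearMap.comp_smul, hP,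
    ContinuousLinearMap.comp_add, ContinuousLinearMap.toLinearMap_smul, map_smul,
    ContinuousLinearMap.toLinearMap_add, map_add, e1, e2, smul_eq_mul]
  ring

/-- The product rule `δ(T(X, ·)) = (δT)(X) - ½ ⟨T, L_X G⟩`. -/
theorem coordCodiff_contract (hG : IsCoordMetric G U) (hy : y ∈ U)
    {T : ℰ n → ℰ n →L[ℝ] ℰ n →L[ℝ] ℝ} (hT : DifferentiableAt ℝ T y)
    (hsymm : ∀ z ∈ U, ∀ u v, T z u v = T z v u) {X : ℰ n → ℰ n} (hX : DifferentiableAt ℝ X y) :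
    coordCodiff G (fun z => T z (X z)) y = coordDiv₂ G T y (X y)
      - LinearMap.trace ℝ (ℰ n) (((G y).inverse.comp (T y)).comp
        ((G y).inverse.comp ((1 / 2 : ℝ) • coordLie G X y))).toLinearMap := by
  have hs : ∀ u v w, fderiv ℝ T y u v w = fderiv ℝ T y u w v := by
    intro u v w
    have : (fun z => T z v w) =ᶠ[nhds y] fun z => T z w v := by
      filter_upwards [hG.isOpen.mem_nhds hy] with z hz using hsymm z hz v w
    rw [← fderiv_const_apply₂ hT, ← fderiv_const_apply₂ hT, this.fderiv_eq]
  rw [hG.trace_coordLie hy _ (hsymm y hy), coordCodiff, coordDiv₂,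
    (hT.hasFDerivAt.clm_apply hX.hasFDerivAt).fderiv]
  simp only [coordCovDeriv₂]
  rw [← Finset.sum_neg_distrib, ← Finset.sum_neg_distrib, ← Finset.sum_sub_distrib]
  refine Finset.sum_congr rfl fun i _ => ?_
  rw [hs _ _ (X y), hsymm y hy _ (X y), hsymm y hy _ (christoffel G y (coordVec i) (X y))]
  simp
  ring

end IsCoordMetric

/-! ### The Riemannian density -/

/-- The Gram matrix of the coordinate fields. -/
def gram (G : ℰ n → ℰ n →L[ℝ] ℰ n →L[ℝ] ℝ) (y : ℰ n) : Matrix (Fin n) (Fin n) ℝ :=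
  Matrix.of fun i j => G y (coordVec i) (coordVec j)

theorem IsCoordMetric.posDef_gram {G : ℰ n → ℰ n →L[ℝ] ℰ n →L[ℝ] ℝ} {U : Set (ℰ n)} {y : ℰ n}
    (hG : IsCoordMetric G U) (hy : y ∈ U) : (gram G y).PosDef := by
  refine Matrix.PosDef.of_dotProduct_mulVec_pos ?_ ?_
  · ext i j
    simp [gram, hG.symm y hy (coordVec i)]
  · intro x hx
    have hx' : (∑ i, x i • coordVec i : ℰ n) ≠ 0 := by
      intro h0
      apply hx
      ext j
      have := congrArg (coordForm j) h0
      simpa [coordForm, coordVec, Pi.single_apply] using this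
    have := hG.pos y hy _ hx'
    simpa [gram, dotProduct, Matrix.mulVec, Finset.mul_sum, mul_comm, mul_left_comm,
      hG.symm y hy (coordVec _) (coordVec _)] using this

theorem hasDerivAt_det_one_add_smul (N : Matrix (Fin n) (Fin n) ℝ) :
    HasDerivAt (fun t : ℝ => (1 + t • N).det) N.trace 0 := by
  have h1 := (Matrix.det (1 + (Polynomial.X : Polynomial ℝ) •
    N.map Polynomial.C)).hasDerivAt (0 : ℝ)
  rw [Matrix.derivative_det_one_add_X_smul] at h1
  refine h1.congr_of_eventuallyEq (Filter.Eventually.of_forall fun t => ?_)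
  change _ = Polynomial.evalRingHom t _
  rw [RingHom.map_det]
  refine congrArg Matrix.det ?_
  ext i j
  by_cases h : i = j <;> simp [h, mul_comm t (N _ _)]

/-- The determinant as a function of the matrix entries, on which the sup norm is available. -/
def detEntries (A : Fin n → Fin n → ℝ) : ℝ := (Matrix.of A).det

theorem contDiff_detEntries : ContDiff ℝ ∞ (detEntries (n := n)) := by
  unfold detEntries
  simp only [Matrix.det_apply, Matrix.of_apply]
  fun_prop

/-- Jacobi's formula for the derivative of the determinant in the direction `C A + A D`. -/
theorem fderiv_detEntries (A C D : Matrix (Fin n) (Fin n) ℝ) :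
    fderiv ℝ detEntries (Matrix.of.symm A) (Matrix.of.symm (C * A + A * D))
      = (C.trace + D.trace) * A.det := by
  have h1 : ∀ N : Matrix (Fin n) (Fin n) ℝ, HasDerivAt (fun t : ℝ => (A + t • N).det)
      (fderiv ℝ detEntries (Matrix.of.symm A) (Matrix.of.symm N)) 0 := by
    intro N
    have h2 : HasDerivAt (fun t : ℝ => Matrix.of.symm A + t • Matrix.of.symm N)
        (Matrix.of.symm N) 0 := by
      simpa using ((hasDerivAt_id (0 : ℝ)).smul_const (Matrix.of.symm N)).const_add
        (Matrix.of.symm A)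
    have h3 : HasFDerivAt detEntries (fderiv ℝ detEntries (Matrix.of.symm A))
        (Matrix.of.symm A + (0 : ℝ) • Matrix.of.symm N) := by
      simpa using (contDiff_detEntries.differentiable (by simp) (Matrix.of.symm A)).hasFDerivAt
    exact h3.comp_hasDerivAt 0 h2
  have hC : fderiv ℝ detEntries (Matrix.of.symm A) (Matrix.of.symm (C * A))
      = C.trace * A.det := by
    refine (h1 (C * A)).unique (((hasDerivAt_det_one_add_smul C).mul_const
      A.det).congr_of_eventuallyEq (Filter.Eventually.of_forall fun t => ?_))
    change (A + t • (C * A)).det = (1 + t • C).det * A.det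
    rw [← Matrix.det_mul, add_mul, one_mul, Matrix.smul_mul]
  have hD : fderiv ℝ detEntries (Matrix.of.symm A) (Matrix.of.symm (A * D))
      = D.trace * A.det := by
    refine (h1 (A * D)).unique (((hasDerivAt_det_one_add_smul D).mul_const
      A.det).congr_of_eventuallyEq (Filter.Eventually.of_forall fun t => ?_))
    change (A + t • (A * D)).det = (1 + t • D).det * A.det
    rw [mul_comm, ← Matrix.det_mul, mul_add, mul_one, Matrix.mul_smul]
  rw [add_mul, ← hC, ← hD, ← map_add]
  rfl

/-- The Riemannian density `√(det g_{ij})`. -/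
def density (G : ℰ n → ℰ n →L[ℝ] ℰ n →L[ℝ] ℝ) (y : ℰ n) : ℝ := √(gram G y).det

namespace IsCoordMetric

variable {G : ℰ n → ℰ n →L[ℝ] ℰ n →L[ℝ] ℝ} {U : Set (ℰ n)} {y : ℰ n}

theorem smooth_entries (hG : IsCoordMetric G U) :
    ContDiffOn ℝ ∞ (fun y => Matrix.of.symm (gram G y)) U :=
  contDiffOn_pi.2 fun _ => contDiffOn_pi.2 fun _ =>
    (hG.smooth.clm_apply contDiffOn_const).clm_apply contDiffOn_const

theorem smooth_density (hG : IsCoordMetric G U) : ContDiffOn ℝ ∞ (density G) U := by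
  have h : ContDiffOn ℝ ∞ (fun y => (gram G y).det) U :=
    contDiff_detEntries.comp_contDiffOn hG.smooth_entries
  exact h.sqrt fun y hy => (hG.posDef_gram hy).det_pos.ne'

theorem density_pos (hG : IsCoordMetric G U) (hy : y ∈ U) : 0 < density G y :=
  Real.sqrt_pos.2 (hG.posDef_gram hy).det_pos

/-- The logarithmic derivative of the density: `∂_u √g = √g tr Γ(u, ·)`. -/
theorem fderiv_density (hG : IsCoordMetric G U) (hy : y ∈ U) (u : ℰ n) :
    fderiv ℝ (density G) y u
      = density G y * ∑ i, coordForm i (christoffel G y u (coordVec i)) := by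
  have hpos := (hG.posDef_gram hy).det_pos
  have hd := hG.differentiableAt hy
  let C : Matrix (Fin n) (Fin n) ℝ :=
    Matrix.of fun i k => coordForm k (christoffel G y u (coordVec i))
  have hE : DifferentiableAt ℝ (fun y => Matrix.of.symm (gram G y)) y :=
    (hG.smooth_entries.contDiffAt (hG.isOpen.mem_nhds hy)).differentiableAt (by simp)
  have h1 : fderiv ℝ (fun y => Matrix.of.symm (gram G y)) y u
      = Matrix.of.symm (C * gram G y + gram G y * C.transpose) := by
    ext i j
    have h2 : HasFDerivAt (fun y => Matrix.of.symm (gram G y)) _ y := hE.hasFDerivAt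
    have h3 := (hasFDerivAt_pi'.1 ((hasFDerivAt_pi'.1 h2) i)) j
    have h4 : fderiv ℝ (fun z => G z (coordVec i) (coordVec j)) y u
      = fderiv ℝ (fun y => Matrix.of.symm (gram G y)) y u i j :=
      congrArg (fun L => L u) h3.fderiv
    rw [← h4, fderiv_const_apply₂ hd, hG.fderiv_eq hy]
    conv_lhs => rw [← sum_coordForm_smul (christoffel G y u (coordVec i)),
      ← sum_coordForm_smul (christoffel G y u (coordVec j))]
    simp [Matrix.mul_apply, C, gram, mul_comm]
  have h5 : HasFDerivAt (fun y => (gram G y).det)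
      ((fderiv ℝ detEntries (Matrix.of.symm (gram G y))).comp
        (fderiv ℝ (fun y => Matrix.of.symm (gram G y)) y)) y :=
    HasFDerivAt.comp (g := detEntries) (f := fun y => Matrix.of.symm (gram G y)) y
      (contDiff_detEntries.differentiable (by simp) _).hasFDerivAt hE.hasFDerivAt
  have h6 := (h5.sqrt hpos.ne').fderiv
  have h7 : fderiv ℝ (density G) y = _ := h6
  rw [h7]
  simp only [smul_apply, ContinuousLinearMap.comp_apply, h1, fderiv_detEntries,
    Matrix.trace_transpose]
  have h8 : C.trace = ∑ i, coordForm i (christoffel G y u (coordVec i)) := rfl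
  rw [h8, density]
  have h9 := Real.mul_self_sqrt hpos.le
  have h10 := (Real.sqrt_pos.2 hpos).ne'
  simp only [smul_eq_mul]
  generalize √(gram G y).det = r at h9 h10 ⊢
  rw [← h9]
  field_simp
  ring

/-- The divergence form `√g δα = -∑ᵢ ∂ᵢ(√g α^i)` of the codifferential. -/
theorem density_mul_coordCodiff (hG : IsCoordMetric G U) (hy : y ∈ U)
    {α : ℰ n → ℰ n →L[ℝ] ℝ} (hα : DifferentiableAt ℝ α y) :
    density G y * coordCodiff G α y
      = -∑ i, fderiv ℝ (fun z => density G z * α z ((G z).inverse (coordForm i))) y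
          (coordVec i) := by
  -- `∂√g = √g tr Γ` cancels against the second Christoffel term in `∂(G⁻¹)`.
  have hI := hG.differentiableAt_inverse hy
  have hD : DifferentiableAt ℝ (density G) y :=
    (hG.smooth_density.contDiffAt (hG.isOpen.mem_nhds hy)).differentiableAt (by simp)
  have h1 : ∀ i, fderiv ℝ (fun z => density G z * α z ((G z).inverse (coordForm i))) y (coordVec i)
      = density G y * ((∑ k, coordForm k (christoffel G y (coordVec i) (coordVec k)))
          * α y ((G y).inverse (coordForm i))
        + fderiv ℝ α y (coordVec i) ((G y).inverse (coordForm i))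
        - α y (christoffel G y (coordVec i) ((G y).inverse (coordForm i)))
        - α y ((G y).inverse ((coordForm i).comp (christoffelL G y (coordVec i))))) := by
    intro i
    have h2 := (hD.hasFDerivAt.fun_mul (hα.hasFDerivAt.clm_apply
      (hI.hasFDerivAt.clm_apply (hasFDerivAt_const (coordForm i) y)))).fderiv
    rw [h2]
    simp [hG.fderiv_density hy, hG.fderiv_inverse hy]
    ring
  have h3 : ∑ i, α y ((G y).inverse ((coordForm i).comp (christoffelL G y (coordVec i))))
      = ∑ i, (∑ k, coordForm k (christoffel G y (coordVec i) (coordVec k)))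
          * α y ((G y).inverse (coordForm i)) := by
    have h4 : ∀ i, α y ((G y).inverse ((coordForm i).comp (christoffelL G y (coordVec i))))
        = ∑ k, coordForm i (christoffel G y (coordVec k) (coordVec i))
          * α y ((G y).inverse (coordForm k)) := by
      intro i
      rw [coordForm_eq_sum ((coordForm i).comp (christoffelL G y (coordVec i)))]
      simp [christoffelL_apply, hG.christoffel_symm hy (coordVec i)]
    simp only [h4, Finset.sum_mul]
    exact Finset.sum_comm
  simp only [h1, ← Finset.mul_sum, Finset.sum_sub_distrib, Finset.sum_add_distrib, h3, coordCodiff]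
  ring

end IsCoordMetric

end CoordinateCalculus

/-! ### Coordinate expressions and change of chart -/

section ManifoldCalculus

variable {n : ℕ} {M : Type*} [TopologicalSpace M] [ChartedSpace (ℰ n) M]

/-- The transition map from the chart at `a` to the chart at `b`. -/
def transition (a b : M) (y : ℰ n) : ℰ n := chartAt (ℰ n) b ((chartAt (ℰ n) a).symm y)

/-- The domain of the transition map from the chart at `a` to the chart at `b`. -/
def overlap (a b : M) : Set (ℰ n) :=
  (chartAt (ℰ n) a).target ∩ (chartAt (ℰ n) a).symm ⁻¹' (chartAt (ℰ n) b).source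

theorem isOpen_overlap (a b : M) : IsOpen (overlap (n := n) a b) :=
  (chartAt (ℰ n) a).symm.isOpen_inter_preimage (chartAt (ℰ n) b).open_source

theorem transition_mem (a b : M) {y : ℰ n} (hy : y ∈ overlap a b) :
    transition a b y ∈ (chartAt (ℰ n) b).target :=
  (chartAt (ℰ n) b).map_source hy.2

theorem symm_transition (a b : M) {y : ℰ n} (hy : y ∈ overlap a b) :
    (chartAt (ℰ n) b).symm (transition a b y) = (chartAt (ℰ n) a).symm y :=
  (chartAt (ℰ n) b).left_inv hy.2

theorem form_congr (θ : OneForm n M) {x x' : M} (h : x = x') {u : TangentSpace (𝓡 n) x}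
    {u' : TangentSpace (𝓡 n) x'} (hu : (u : ℰ n) = u') : θ x u = θ x' u' := by
  subst h
  obtain rfl : u = u' := hu
  rfl

/-- Equality of base points can be substituted once tangent vectors are compared as elements of the
model space, of which all tangent spaces are copies. -/
theorem tensor_congr (φ : TwoTensor n M) {x x' : M} (h : x = x') {u v : TangentSpace (𝓡 n) x}
    {u' v' : TangentSpace (𝓡 n) x'} (hu : (u : ℰ n) = u') (hv : (v : ℰ n) = v') :
    φ x u v = φ x' u' v' := by
  subst h
  obtain rfl : u = u' := hu
  obtain rfl : v = v' := hv
  rfl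

theorem contMDiff_iff_forall_source {E' H' M' : Type*} [NormedAddCommGroup E'] [NormedSpace ℝ E']
    [TopologicalSpace H'] (I' : ModelWithCorners ℝ E' H') [TopologicalSpace M']
    [ChartedSpace H' M'] (f : M → M') :
    ContMDiff (𝓡 n) I' ∞ f ↔ ∀ a, ContMDiffOn (𝓡 n) I' ∞ f (chartAt (ℰ n) a).source :=
  ⟨fun h _ => h.contMDiffOn, fun h x => (h x x (mem_chart_source _ x)).contMDiffAt
    ((chartAt (ℰ n) x).open_source.mem_nhds (mem_chart_source _ x))⟩

theorem tensorInChart_smul_sub (φ ψ : TwoTensor n M) (f : M → ℝ) (a : M) (y : ℰ n) :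
    tensorInChart (chartAt (ℰ n) a) (fun x => φ x - f x • ψ x) y
      = tensorInChart (chartAt (ℰ n) a) φ y - f ((chartAt (ℰ n) a).symm y) •
        tensorInChart (chartAt (ℰ n) a) ψ y := by
  ext u v; rfl

variable [IsManifold (𝓡 n) ∞ M]

theorem mdifferentiable_chartAt (a : M) :
    (chartAt (ℰ n) a).MDifferentiable (𝓡 n) 𝓘(ℝ, ℰ n) :=
  mdifferentiable_chart a

theorem chartDeriv_chartSymmDeriv (a : M) {y : ℰ n} (hy : y ∈ (chartAt (ℰ n) a).target) (v : ℰ n) :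
    chartDeriv (chartAt (ℰ n) a) ((chartAt (ℰ n) a).symm y)
      (chartSymmDeriv (chartAt (ℰ n) a) y v) = v :=
  congrArg (fun L => L v) ((mdifferentiable_chartAt a).comp_symm_deriv hy)

theorem chartSymmDeriv_chartDeriv (b : M) {x : M} (hx : x ∈ (chartAt (ℰ n) b).source)
    (v : TangentSpace (𝓡 n) x) :
    (chartSymmDeriv (chartAt (ℰ n) b) (chartAt (ℰ n) b x) (chartDeriv (chartAt (ℰ n) b) x v) : ℰ n)
      = v :=
  congrArg (fun L => L v) ((mdifferentiable_chartAt b).symm_comp_deriv hx)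

theorem chartSymmDeriv_chartDeriv_symm (a : M) {y : ℰ n} (hy : y ∈ (chartAt (ℰ n) a).target)
    (v : TangentSpace (𝓡 n) ((chartAt (ℰ n) a).symm y)) :
    chartSymmDeriv (chartAt (ℰ n) a) y
      (chartDeriv (chartAt (ℰ n) a) ((chartAt (ℰ n) a).symm y) v) = v := by
  have h : ∀ y', y' = y → ∀ w : ℰ n, (chartSymmDeriv (chartAt (ℰ n) a) y' w : ℰ n)
      = chartSymmDeriv (chartAt (ℰ n) a) y w := by
    rintro _ rfl w; rfl
  exact (h _ ((chartAt (ℰ n) a).right_inv hy) _).symm.trans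
    (chartSymmDeriv_chartDeriv a ((chartAt (ℰ n) a).map_target hy) v)

/-- The differential of the chart at `a` as an isomorphism `T_x M ≃ ℝⁿ`. -/
def chartEquiv (a : M) {x : M} (hx : x ∈ (chartAt (ℰ n) a).source) :
    TangentSpace (𝓡 n) x ≃L[ℝ] ℰ n :=
  (mdifferentiable_chartAt a).mfderiv hx

theorem coe_chartEquiv (a : M) {x : M} (hx : x ∈ (chartAt (ℰ n) a).source) :
    (chartEquiv a hx : TangentSpace (𝓡 n) x →L[ℝ] ℰ n) = chartDeriv (chartAt (ℰ n) a) x := rfl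

/-- A two-tensor is the pullback of its coordinate expression. -/
theorem tensor_eq_pullForm (φ : TwoTensor n M) (a : M) {x : M}
    (hx : x ∈ (chartAt (ℰ n) a).source) :
    φ x = pullForm (tensorInChart (chartAt (ℰ n) a) φ (chartAt (ℰ n) a x))
      (chartEquiv a hx : TangentSpace (𝓡 n) x →L[ℝ] ℰ n) := by
  ext u v
  exact (tensor_congr φ ((chartAt (ℰ n) a).left_inv hx) (chartSymmDeriv_chartDeriv a hx u)
    (chartSymmDeriv_chartDeriv a hx v)).symm

theorem transition_smooth (a b : M) : ContDiffOn ℝ ∞ (transition (n := n) a b) (overlap a b) := by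
  rw [← contMDiffOn_iff_contDiffOn]
  exact (contMDiffOn_chart (I := 𝓡 n) (n := ∞) (x := b)).comp
    ((contMDiffOn_chart_symm (I := 𝓡 n) (n := ∞) (x := a)).mono Set.inter_subset_left)
    Set.inter_subset_right

theorem fderiv_transition (a b : M) {y : ℰ n} (hy : y ∈ overlap a b) (v : ℰ n) :
    fderiv ℝ (transition a b) y v = chartDeriv (chartAt (ℰ n) b) ((chartAt (ℰ n) a).symm y)
      (chartSymmDeriv (chartAt (ℰ n) a) y v) := by
  have h := mfderiv_comp (I := 𝓘(ℝ, ℰ n)) (I' := 𝓡 n) (I'' := 𝓘(ℝ, ℰ n)) y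
    ((mdifferentiable_chartAt b).mdifferentiableAt hy.2)
    ((mdifferentiable_chartAt a).mdifferentiableAt_symm hy.1)
  rw [mfderiv_eq_fderiv] at h
  exact congrArg (fun L => L v) h

theorem chartSymmDeriv_transition (a b : M) {y : ℰ n} (hy : y ∈ overlap a b) (v : ℰ n) :
    (chartSymmDeriv (chartAt (ℰ n) b) (transition a b y) (fderiv ℝ (transition a b) y v) : ℰ n)
      = chartSymmDeriv (chartAt (ℰ n) a) y v := by
  rw [fderiv_transition a b hy]
  exact chartSymmDeriv_chartDeriv b hy.2 _

theorem tensorInChart_transition (φ : TwoTensor n M) (a b : M) {y : ℰ n} (hy : y ∈ overlap a b) :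
    tensorInChart (chartAt (ℰ n) a) φ y
      = pullForm (tensorInChart (chartAt (ℰ n) b) φ (transition a b y))
          (fderiv ℝ (transition a b) y) := by
  ext u v
  exact (tensor_congr φ (symm_transition a b hy) (chartSymmDeriv_transition a b hy u)
    (chartSymmDeriv_transition a b hy v)).symm

theorem formInChart_transition (θ : OneForm n M) (a b : M) {y : ℰ n} (hy : y ∈ overlap a b) :
    formInChart (chartAt (ℰ n) a) θ y
      = (formInChart (chartAt (ℰ n) b) θ (transition a b y)).comp
          (fderiv ℝ (transition a b) y) := by
  ext u
  exact (form_congr θ (symm_transition a b hy) (chartSymmDeriv_transition a b hy u)).symm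

/-! ### Smoothness in charts -/

theorem contMDiffOn_source_iff {F : Type*} [NormedAddCommGroup F] [NormedSpace ℝ F] (f : M → F)
    (a : M) :
    ContMDiffOn (𝓡 n) 𝓘(ℝ, F) ∞ f (chartAt (ℰ n) a).source
      ↔ ContDiffOn ℝ ∞ (fun y => f ((chartAt (ℰ n) a).symm y)) (chartAt (ℰ n) a).target := by
  constructor
  · intro h
    rw [← contMDiffOn_iff_contDiffOn]
    exact h.comp (contMDiffOn_chart_symm (I := 𝓡 n) (n := ∞) (x := a))
      fun y hy => (chartAt (ℰ n) a).map_target hy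
  · intro h
    rw [← contMDiffOn_iff_contDiffOn] at h
    refine (h.comp (contMDiffOn_chart (I := 𝓡 n) (n := ∞) (x := a))
      fun x hx => (chartAt (ℰ n) a).map_source hx).congr fun x hx => ?_
    simp [(chartAt (ℰ n) a).left_inv hx]

theorem contMDiff_iff_chart (f : M → ℝ) : ContMDiff (𝓡 n) 𝓘(ℝ, ℝ) ∞ f ↔
    ∀ a, ContDiffOn ℝ ∞ (fun y => f ((chartAt (ℰ n) a).symm y)) (chartAt (ℰ n) a).target := by
  simp only [contMDiff_iff_forall_source, contMDiffOn_source_iff]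

theorem symmL_trivializationAt_eq (a : M) {x : M} (hx : x ∈ (chartAt (ℰ n) a).source) (v : ℰ n) :
    ((trivializationAt (ℰ n) (TangentSpace (𝓡 n)) a).symmL ℝ x v : ℰ n)
      = chartSymmDeriv (chartAt (ℰ n) a) (chartAt (ℰ n) a x) v := by
  rw [TangentBundle.symmL_trivializationAt hx]
  simp only [modelWithCornersSelf_coe, Set.range_id, mfderivWithin_univ]
  rfl

theorem continuousLinearMapAt_trivializationAt_eq (a : M) {x : M}
    (hx : x ∈ (chartAt (ℰ n) a).source) :
    (trivializationAt (ℰ n) (TangentSpace (𝓡 n)) a).continuousLinearMapAt ℝ x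
      = chartDeriv (chartAt (ℰ n) a) x := by
  rw [TangentBundle.continuousLinearMapAt_trivializationAt hx]
  exact (hasMFDerivAt_extChartAt hx).mfderiv

theorem smoothVField_iff (X : VField n M) : SmoothVField X ↔
    ∀ a, ContDiffOn ℝ ∞ (vfieldInChart (chartAt (ℰ n) a) X) (chartAt (ℰ n) a).target := by
  rw [SmoothVField, contMDiff_iff_forall_source]
  refine forall_congr' fun a => ?_
  have hb : (trivializationAt (ℰ n) (TangentSpace (𝓡 n)) a).baseSet = (chartAt (ℰ n) a).source :=
    rfl
  have h := (trivializationAt (ℰ n) (TangentSpace (𝓡 n)) a).contMDiffOn_section_baseSet_iff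
    (IB := 𝓡 n) (n := ∞) (s := X)
  rw [hb, contMDiffOn_source_iff] at h
  refine h.trans (contDiffOn_congr fun y hy => ?_)
  have hx := (chartAt (ℰ n) a).map_target hy
  rw [vfieldInChart, ← continuousLinearMapAt_trivializationAt_eq a hx]
  rw [Bundle.Trivialization.continuousLinearMapAt_apply,
    Bundle.Trivialization.linearMapAt_apply, if_pos]
  exact hx

theorem smoothOneForm_iff (θ : OneForm n M) : SmoothOneForm θ ↔
    ∀ a, ContDiffOn ℝ ∞ (formInChart (chartAt (ℰ n) a) θ) (chartAt (ℰ n) a).target := by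
  rw [SmoothOneForm, contMDiff_iff_forall_source]
  refine forall_congr' fun a => ?_
  let e := trivializationAt (ℰ n →L[ℝ] ℝ) (fun x : M => TangentSpace (𝓡 n) x →L[ℝ] ℝ) a
  have hb : e.baseSet = (chartAt (ℰ n) a).source := by
    simp [e]
  have h := e.contMDiffOn_section_baseSet_iff (IB := 𝓡 n) (n := ∞) (s := θ)
  rw [hb, contMDiffOn_source_iff] at h
  refine h.trans (contDiffOn_congr fun y hy => ?_)
  have hx := (chartAt (ℰ n) a).map_target hy
  ext v
  have h1 : e ⟨(chartAt (ℰ n) a).symm y, θ _⟩ = _ := hom_trivializationAt_apply _ _ _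
  rw [h1]
  have h2 := symmL_trivializationAt_eq a hx v
  rw [(chartAt (ℰ n) a).right_inv hy] at h2
  refine (congrArg (fun L : ℝ →L[ℝ] ℝ => L _) (Bundle.Trivial.continuousLinearMapAt_trivialization
    ℝ M ℝ ((chartAt (ℰ n) a).symm y))).trans ?_
  exact form_congr θ rfl h2

theorem smoothTwoTensor_iff (φ : TwoTensor n M) : SmoothTwoTensor φ ↔
    ∀ a, ContDiffOn ℝ ∞ (tensorInChart (chartAt (ℰ n) a) φ) (chartAt (ℰ n) a).target := by
  rw [SmoothTwoTensor, contMDiff_iff_forall_source]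
  refine forall_congr' fun a => ?_
  let e := trivializationAt (ℰ n →L[ℝ] ℰ n →L[ℝ] ℝ)
    (fun x : M => TangentSpace (𝓡 n) x →L[ℝ] TangentSpace (𝓡 n) x →L[ℝ] ℝ) a
  have hb : e.baseSet = (chartAt (ℰ n) a).source := by
    simp [e]
  have h := e.contMDiffOn_section_baseSet_iff (IB := 𝓡 n) (n := ∞) (s := φ)
  rw [hb, contMDiffOn_source_iff] at h
  refine h.trans (contDiffOn_congr fun y hy => ?_)
  have hx := (chartAt (ℰ n) a).map_target hy
  ext v w
  have h1 : e ⟨(chartAt (ℰ n) a).symm y, φ _⟩ = _ := hom_trivializationAt_apply _ _ _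
  rw [h1]
  have h2 := symmL_trivializationAt_eq a hx v
  have h3 := symmL_trivializationAt_eq a hx w
  rw [(chartAt (ℰ n) a).right_inv hy] at h2 h3
  rw [Bundle.Trivialization.symmL_apply _ hx] at h2 h3
  refine (inCoordinates_apply_eq₂ hx hx (Set.mem_univ _)).trans ?_
  refine (congrArg (fun L : ℝ →ₗ[ℝ] ℝ => L _) (Bundle.Trivial.linearMapAt_trivialization
    ℝ M ℝ ((chartAt (ℰ n) a).symm y))).trans ?_
  exact tensor_congr φ rfl h2 h3

end ManifoldCalculus

/-! ### Metric operations, curvature and codifferential in a chart -/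

section ManifoldCalculus

variable {n : ℕ} {M : Type*} [TopologicalSpace M] [ChartedSpace (ℰ n) M] [IsManifold (𝓡 n) ∞ M]

variable (g : Metric n M)

theorem isCoordMetric_inner (a : M) :
    IsCoordMetric (tensorInChart (chartAt (ℰ n) a) g.inner) (chartAt (ℰ n) a).target where
  isOpen := (chartAt (ℰ n) a).open_target
  smooth := (smoothTwoTensor_iff g.inner).1 g.contMDiff a
  symm _ _ _ _ := g.symm _ _ _
  pos y hy v hv := g.pos _ _ fun h0 => hv <| by
    have h1 : chartSymmDeriv (chartAt (ℰ n) a) y v = 0 := h0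
    rw [← chartDeriv_chartSymmDeriv a hy v, h1, map_zero]

theorem isCoordIsometry_transition (a b : M) :
    IsCoordIsometry (transition a b) (tensorInChart (chartAt (ℰ n) a) g.inner) (overlap a b)
      (tensorInChart (chartAt (ℰ n) b) g.inner) (chartAt (ℰ n) b).target where
  source :=
    { isOpen := isOpen_overlap a b
      smooth := (isCoordMetric_inner g a).smooth.mono Set.inter_subset_left
      symm := fun y hy => (isCoordMetric_inner g a).symm y hy.1
      pos := fun y hy => (isCoordMetric_inner g a).pos y hy.1 }
  target := isCoordMetric_inner g b
  smooth := transition_smooth a b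
  mapsTo := fun _ hy => transition_mem a b hy
  pull := fun _ hy => tensorInChart_transition g.inner a b hy

theorem traceG_eq (φ : TwoTensor n M) (a : M) {x : M} (hx : x ∈ (chartAt (ℰ n) a).source) :
    traceG g φ x = coordTrace (tensorInChart (chartAt (ℰ n) a) g.inner)
      (tensorInChart (chartAt (ℰ n) a) φ) (chartAt (ℰ n) a x) := by
  have hG := isCoordMetric_inner g a
  have hy := (chartAt (ℰ n) a).map_source hx
  rw [coordTrace, hG.sum_contract_eq_trace hy, ← trace_pullForm _ _ (hG.isInvertible hy)
    (chartEquiv a hx), ← tensor_eq_pullForm, ← tensor_eq_pullForm]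
  rfl

/-- The inner product of two-tensors, computed from representations in a chart at `a`. -/
theorem innerG_eq (φ ψ : TwoTensor n M) (a : M) {x : M} (hx : x ∈ (chartAt (ℰ n) a).source)
    (Φ Ψ : ℰ n →L[ℝ] ℰ n →L[ℝ] ℝ)
    (hΦ : φ x = pullForm Φ (chartDeriv (chartAt (ℰ n) a) x))
    (hΨ : ψ x = pullForm Ψ (chartDeriv (chartAt (ℰ n) a) x)) :
    innerG g φ ψ x = LinearMap.trace ℝ (ℰ n)
      (((tensorInChart (chartAt (ℰ n) a) g.inner (chartAt (ℰ n) a x)).inverse.comp Ψ).comp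
      ((tensorInChart (chartAt (ℰ n) a) g.inner (chartAt (ℰ n) a x)).inverse.comp
        Φ)).toLinearMap := by
  have hG := isCoordMetric_inner g a
  have hy := (chartAt (ℰ n) a).map_source hx
  rw [← trace_pullForm₂ _ _ _ (hG.isInvertible hy) (chartEquiv a hx), ← tensor_eq_pullForm,
    coe_chartEquiv, ← hΦ, ← hΨ]
  rfl

/-- The Ricci tensor is defined in the preferred chart of each point; by naturality it is computed
by any fixed chart around the point. -/
theorem tensorInChart_ricci (a : M) {y : ℰ n} (hy : y ∈ (chartAt (ℰ n) a).target) :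
    tensorInChart (chartAt (ℰ n) a) (ricci g) y
      = coordRicci (tensorInChart (chartAt (ℰ n) a) g.inner) y := by
  set b := (chartAt (ℰ n) a).symm y with hb
  have hy' : y ∈ overlap a b := ⟨hy, mem_chart_source _ b⟩
  rw [(isCoordIsometry_transition g a b).coordRicci_eq hy']
  ext u v
  rw [pullForm_apply, fderiv_transition a b hy', fderiv_transition a b hy']
  rfl

theorem scalarCurv_eq (a : M) {y : ℰ n} (hy : y ∈ (chartAt (ℰ n) a).target) :
    scalarCurv g ((chartAt (ℰ n) a).symm y)
      = coordTrace (tensorInChart (chartAt (ℰ n) a) g.inner)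
        (coordRicci (tensorInChart (chartAt (ℰ n) a) g.inner)) y := by
  rw [scalarCurv, traceG_eq g _ a ((chartAt (ℰ n) a).map_target hy),
    (chartAt (ℰ n) a).right_inv hy, coordTrace, coordTrace, tensorInChart_ricci g a hy]

theorem IsCoordMetric.smooth_coordTrace {G Φ : ℰ n → ℰ n →L[ℝ] ℰ n →L[ℝ] ℝ}
    {U : Set (ℰ n)} (hG : IsCoordMetric G U) (hΦ : ContDiffOn ℝ ∞ Φ U) :
    ContDiffOn ℝ ∞ (coordTrace G Φ) U :=
  ContDiffOn.sum fun _ _ => (hΦ.clm_apply contDiffOn_const).clm_apply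
    (hG.smooth_inverse.clm_apply contDiffOn_const)

theorem smooth_scalarCurv : ContMDiff (𝓡 n) 𝓘(ℝ, ℝ) ∞ (scalarCurv g) := by
  rw [contMDiff_iff_chart]
  intro a
  have hG := isCoordMetric_inner g a
  exact (hG.smooth_coordTrace hG.smooth_coordRicci).congr fun y hy => scalarCurv_eq g a hy

theorem smooth_ricci₀ : SmoothTwoTensor (ricci₀ g) := by
  rw [smoothTwoTensor_iff]
  intro a
  have hG := isCoordMetric_inner g a
  have hs := (contMDiff_iff_chart _).1 (smooth_scalarCurv g) a
  refine ((hG.smooth_coordRicci).sub ((hs.div_const (n : ℝ)).smul hG.smooth)).congr fun y hy => ?_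
  refine (tensorInChart_smul_sub (ricci g) g.inner (fun x => scalarCurv g x / n) a y).trans ?_
  rw [tensorInChart_ricci g a hy]
  rfl

/-- By naturality the codifferential is computed by any chart around the point. -/
theorem codiff_eq {θ : OneForm n M} (hθ : SmoothOneForm θ) (a : M) {y : ℰ n}
    (hy : y ∈ (chartAt (ℰ n) a).target) :
    codiff g θ ((chartAt (ℰ n) a).symm y)
      = coordCodiff (tensorInChart (chartAt (ℰ n) a) g.inner)
        (formInChart (chartAt (ℰ n) a) θ) y := by
  set b := (chartAt (ℰ n) a).symm y with hb
  have hy' : y ∈ overlap a b := ⟨hy, mem_chart_source _ b⟩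
  have hd : DifferentiableAt ℝ (formInChart (chartAt (ℰ n) b) θ) (transition a b y) :=
    (((smoothOneForm_iff θ).1 hθ b).contDiffAt ((chartAt (ℰ n) b).open_target.mem_nhds
      (transition_mem a b hy'))).differentiableAt (by simp)
  rw [(isCoordIsometry_transition g a b).coordCodiff_eq hy' hd
    fun z hz => formInChart_transition θ a b hz]
  rfl

theorem IsCoordMetric.smooth_coordCodiff {G : ℰ n → ℰ n →L[ℝ] ℰ n →L[ℝ] ℝ}
    {U : Set (ℰ n)} (hG : IsCoordMetric G U) {α : ℰ n → ℰ n →L[ℝ] ℝ} (hα : ContDiffOn ℝ ∞ α U) :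
    ContDiffOn ℝ ∞ (coordCodiff G α) U := by
  have h1 : ContDiffOn ℝ ∞ (fderiv ℝ α) U := hα.fderiv_of_isOpen hG.isOpen (by simp)
  have h2 : ∀ i : Fin n, ContDiffOn ℝ ∞ (fun y => (G y).inverse (coordForm i)) U :=
    fun i => hG.smooth_inverse.clm_apply contDiffOn_const
  refine (ContDiffOn.sum fun i _ => ?_).neg
  simp only [← christoffelL_apply]
  exact ((h1.clm_apply contDiffOn_const).clm_apply (h2 i)).sub (hα.clm_apply
    ((hG.smooth_christoffelL.clm_apply contDiffOn_const).clm_apply (h2 i)))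

theorem smooth_codiff {θ : OneForm n M} (hθ : SmoothOneForm θ) :
    ContMDiff (𝓡 n) 𝓘(ℝ, ℝ) ∞ (codiff g θ) := by
  rw [contMDiff_iff_chart]
  intro a
  exact ((isCoordMetric_inner g a).smooth_coordCodiff ((smoothOneForm_iff θ).1 hθ a)).congr
    fun y hy => codiff_eq g hθ a hy

theorem isInvertible_inner (x : M) : (g.inner x).IsInvertible :=
  isInvertible_of_pos (V := ℰ n) (g.inner x) (g.pos x)

theorem inner_sharp (θ : OneForm n M) (x : M) : g.inner x (sharp g θ x) = θ x :=
  (isInvertible_inner g x).self_apply_inverse _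

theorem vfieldInChart_sharp (θ : OneForm n M) (a : M) {y : ℰ n}
    (hy : y ∈ (chartAt (ℰ n) a).target) :
    vfieldInChart (chartAt (ℰ n) a) (sharp g θ) y
      = (tensorInChart (chartAt (ℰ n) a) g.inner y).inverse
        (formInChart (chartAt (ℰ n) a) θ y) := by
  have hG := isCoordMetric_inner g a
  refine hG.eq_of_forall hy fun w => ?_
  rw [hG.apply_inverse hy]
  have h := chartSymmDeriv_chartDeriv_symm a hy (sharp g θ ((chartAt (ℰ n) a).symm y))
  have h2 := congrArg (fun L => L (chartSymmDeriv (chartAt (ℰ n) a) y w))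
    (inner_sharp g θ ((chartAt (ℰ n) a).symm y))
  rw [← h] at h2
  exact h2

theorem smooth_sharp {θ : OneForm n M} (hθ : SmoothOneForm θ) : SmoothVField (sharp g θ) := by
  rw [smoothVField_iff]
  intro a
  exact ((isCoordMetric_inner g a).smooth_inverse.clm_apply ((smoothOneForm_iff θ).1 hθ a)).congr
    fun y hy => vfieldInChart_sharp g θ a hy

end ManifoldCalculus

/-! ### The Riemannian volume measure -/

section ManifoldCalculus

variable {n : ℕ} {M : Type*} [TopologicalSpace M] [ChartedSpace (ℰ n) M]

/-- The determinant of the Gram matrix of a pullback. -/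
theorem gram_pullForm (b : ℰ n →L[ℝ] ℰ n →L[ℝ] ℝ) (A : ℰ n →L[ℝ] ℰ n) :
    (Matrix.of fun i j : Fin n => pullForm b A (coordVec i) (coordVec j)).det
      = A.det ^ 2 * (Matrix.of fun i j : Fin n => b (coordVec i) (coordVec j)).det := by
  let C : Matrix (Fin n) (Fin n) ℝ := Matrix.of fun i k => coordForm k (A (coordVec i))
  have hC : C.transpose = LinearMap.toMatrix (EuclideanSpace.basisFun (Fin n) ℝ).toBasis
      (EuclideanSpace.basisFun (Fin n) ℝ).toBasis A.toLinearMap := by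
    ext i j
    simp [C, LinearMap.toMatrix_apply, coordForm, coordVec]
  have hdet : C.det = A.det := by
    rw [← Matrix.det_transpose, hC, LinearMap.det_toMatrix]
  have h : (Matrix.of fun i j : Fin n => pullForm b A (coordVec i) (coordVec j))
      = C * (Matrix.of fun i j : Fin n => b (coordVec i) (coordVec j)) * C.transpose := by
    ext i j
    simp only [Matrix.of_apply, pullForm_apply]
    conv_lhs => rw [← sum_coordForm_smul (A (coordVec i)), ← sum_coordForm_smul (A (coordVec j))]
    simp [Matrix.mul_apply, C, mul_comm, Finset.mul_sum]
  rw [h, Matrix.det_mul, Matrix.det_mul, Matrix.det_transpose, hdet]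
  ring

/-- The density transforms with the Jacobian of an isometry. -/
theorem IsCoordIsometry.density_eq {ψ : ℰ n → ℰ n} {G' G : ℰ n → ℰ n →L[ℝ] ℰ n →L[ℝ] ℝ}
    {U' U : Set (ℰ n)} {y : ℰ n} (h : IsCoordIsometry ψ G' U' G U) (hy : y ∈ U') :
    density G' y = |(fderiv ℝ ψ y).det| * density G (ψ y) := by
  rw [density, gram, h.pull y hy, gram_pullForm, Real.sqrt_mul (sq_nonneg _), Real.sqrt_sq_eq_abs]
  rfl

section Volume

theorem continuousOn_density [IsManifold (𝓡 n) ∞ M] (g : Metric n M) (a : M) :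
    ContinuousOn (density (tensorInChart (chartAt (ℰ n) a) g.inner)) (chartAt (ℰ n) a).target :=
  (isCoordMetric_inner g a).smooth_density.continuousOn

variable [MeasurableSpace M] [BorelSpace M]

theorem aemeasurable_chart_symm (a : M) :
    AEMeasurable (chartAt (ℰ n) a).symm (volume.restrict (chartAt (ℰ n) a).target) :=
  (chartAt (ℰ n) a).continuousOn_symm.aemeasurable (chartAt (ℰ n) a).open_target.measurableSet

theorem measurableSet_preimage_symm_inter_target (a : M) {B : Set M} (hB : MeasurableSet B) :
    MeasurableSet ((chartAt (ℰ n) a).symm ⁻¹' B ∩ (chartAt (ℰ n) a).target) := by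
  have h := (continuousOn_iff_continuous_domRestrict.1
    (chartAt (ℰ n) a).continuousOn_symm).measurable hB
  have h2 := (MeasurableEmbedding.subtype_coe
    (chartAt (ℰ n) a).open_target.measurableSet).measurableSet_image.2 h
  convert h2 using 1
  ext y
  simp [and_comm]

variable [IsManifold (𝓡 n) ∞ M] (g : Metric n M)

theorem chartVolume_apply (a : M) {B : Set M} (hB : MeasurableSet B) :
    chartVolume g (chartAt (ℰ n) a) B
      = ∫⁻ y in (chartAt (ℰ n) a).symm ⁻¹' B ∩ (chartAt (ℰ n) a).target,
          ENNReal.ofReal (density (tensorInChart (chartAt (ℰ n) a) g.inner) y) := by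
  rw [chartVolume, Measure.map_apply_of_aemeasurable _ hB, withDensity_apply',
    Measure.restrict_restrict' (chartAt (ℰ n) a).open_target.measurableSet]
  · rfl
  · exact (aemeasurable_chart_symm a).mono_ac (withDensity_absolutelyContinuous _ _)

theorem chartVolume_compl_source (a : M) :
    chartVolume g (chartAt (ℰ n) a) (chartAt (ℰ n) a).sourceᶜ = 0 := by
  rw [chartVolume_apply g a (chartAt (ℰ n) a).open_source.measurableSet.compl]
  have : (chartAt (ℰ n) a).symm ⁻¹' (chartAt (ℰ n) a).sourceᶜ ∩ (chartAt (ℰ n) a).target = ∅ := by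
    ext y
    simp only [Set.mem_inter_iff, Set.mem_preimage, Set.mem_compl_iff, Set.mem_empty_iff_false,
      iff_false, not_and]
    exact fun h hy => h ((chartAt (ℰ n) a).map_target hy)
  rw [this]
  simp

/-- The measures `√g dx` of two charts agree on the overlap, by the change of variables formula. -/
theorem chartVolume_eq (a b : M) {B : Set M} (hB : MeasurableSet B)
    (ha : B ⊆ (chartAt (ℰ n) a).source) (hb : B ⊆ (chartAt (ℰ n) b).source) :
    chartVolume g (chartAt (ℰ n) a) B = chartVolume g (chartAt (ℰ n) b) B := by
  set s := (chartAt (ℰ n) a).symm ⁻¹' B ∩ (chartAt (ℰ n) a).target with hs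
  have hsub : s ⊆ overlap a b := fun y hy => ⟨hy.2, hb hy.1⟩
  have himg : (chartAt (ℰ n) b).symm ⁻¹' B ∩ (chartAt (ℰ n) b).target = transition a b '' s := by
    ext z
    constructor
    · rintro ⟨h1, h2⟩
      refine ⟨chartAt (ℰ n) a ((chartAt (ℰ n) b).symm z), ⟨?_, ?_⟩, ?_⟩
      · rw [Set.mem_preimage, (chartAt (ℰ n) a).left_inv (ha h1)]
        exact h1
      · exact (chartAt (ℰ n) a).map_source (ha h1)
      · rw [transition, (chartAt (ℰ n) a).left_inv (ha h1), (chartAt (ℰ n) b).right_inv h2]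
    · rintro ⟨y, hy, rfl⟩
      refine ⟨?_, transition_mem a b (hsub hy)⟩
      rw [Set.mem_preimage, symm_transition a b (hsub hy)]
      exact hy.1
  have hinj : Set.InjOn (transition (n := n) a b) s := by
    intro y hy z hz hyz
    have := congrArg (chartAt (ℰ n) b).symm hyz
    rw [symm_transition a b (hsub hy), symm_transition a b (hsub hz)] at this
    exact (chartAt (ℰ n) a).symm.injOn hy.2 hz.2 this
  have hiso := isCoordIsometry_transition g a b
  have hms : MeasurableSet s := measurableSet_preimage_symm_inter_target a hB
  rw [chartVolume_apply g a hB, chartVolume_apply g b hB, himg,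
    lintegral_image_eq_lintegral_abs_det_fderiv_mul volume hms
      (fun y hy => (hiso.differentiableAt (hsub hy)).hasFDerivAt.hasFDerivWithinAt) hinj]
  refine setLIntegral_congr_fun hms fun y hy => ?_
  rw [← ENNReal.ofReal_mul (abs_nonneg _), hiso.density_eq (hsub hy)]

/-- On a chart domain the volume measure is the measure `√(det g) dx` of that chart. -/
theorem volumeG_restrict_source (a : M) :
    (volumeG g).restrict (chartAt (ℰ n) a).source = chartVolume g (chartAt (ℰ n) a) := by
  set S := (chartAt (ℰ n) a).source with hS
  have hSm : MeasurableSet S := (chartAt (ℰ n) a).open_source.measurableSet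
  -- On `S` every chart measure is bounded by that of the chart at `a`, since they agree on
  -- overlaps; hence the right hand side is an upper bound, and dominates the supremum.
  have hle : volumeG g ≤ (chartVolume g (chartAt (ℰ n) a)).restrict S
      + (volumeG g).restrict Sᶜ := by
    refine iSup_le fun b => Measure.le_iff.2 fun C hC => ?_
    rw [Measure.add_apply, Measure.restrict_apply hC, Measure.restrict_apply hC,
      ← measure_inter_add_sdiff C hSm]
    refine add_le_add ?_ (Measure.le_iff'.1 (le_iSup (fun b =>
      chartVolume g (chartAt (ℰ n) b)) b) _)
    have hbm : MeasurableSet (chartAt (ℰ n) b).source :=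
      (chartAt (ℰ n) b).open_source.measurableSet
    rw [← measure_inter_add_sdiff (C ∩ S) hbm]
    have h0 : chartVolume g (chartAt (ℰ n) b) ((C ∩ S) \ (chartAt (ℰ n) b).source) = 0 :=
      measure_mono_null (fun x hx => hx.2) (chartVolume_compl_source g b)
    rw [h0, add_zero, chartVolume_eq g b a ((hC.inter hSm).inter hbm) Set.inter_subset_right
      (fun x hx => hx.1.2)]
    exact measure_mono Set.inter_subset_left
  ext B hB
  rw [Measure.restrict_apply hB]
  have h0 : chartVolume g (chartAt (ℰ n) a) (B \ S) = 0 :=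
      measure_mono_null (fun x hx => hx.2) (chartVolume_compl_source g a)
  have h1 : chartVolume g (chartAt (ℰ n) a) B = chartVolume g (chartAt (ℰ n) a) (B ∩ S) := by
    rw [← measure_inter_add_sdiff B hSm, h0, add_zero]
  rw [h1]
  refine le_antisymm ?_ (Measure.le_iff'.1 (le_iSup (fun b =>
      chartVolume g (chartAt (ℰ n) b)) a) _)
  refine (Measure.le_iff'.1 hle _).trans ?_
  rw [Measure.add_apply, Measure.restrict_apply (hB.inter hSm),
    Measure.restrict_apply (hB.inter hSm), Set.inter_assoc,
    Set.inter_self, Set.inter_assoc, Set.inter_compl_self]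
  simp

theorem volumeG_apply (a : M) {B : Set M} (hB : MeasurableSet B)
    (ha : B ⊆ (chartAt (ℰ n) a).source) :
    volumeG g B = ∫⁻ y in (chartAt (ℰ n) a).symm ⁻¹' B ∩ (chartAt (ℰ n) a).target,
          ENNReal.ofReal (density (tensorInChart (chartAt (ℰ n) a) g.inner) y) := by
  rw [← chartVolume_apply g a hB, ← volumeG_restrict_source, Measure.restrict_apply hB,
    Set.inter_eq_left.2 ha]

instance isLocallyFiniteMeasure_volumeG : IsLocallyFiniteMeasure (volumeG g) where
  finiteAtNhds x := by
    obtain ⟨r, hr, hball⟩ := Metric.nhds_basis_closedBall.mem_iff.1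
      ((chartAt (ℰ n) x).open_target.mem_nhds (mem_chart_target _ x))
    have hopen : IsOpen ((chartAt (ℰ n) x).source ∩
        chartAt (ℰ n) x ⁻¹' Metric.ball (chartAt (ℰ n) x x) r) :=
      (chartAt (ℰ n) x).isOpen_inter_preimage Metric.isOpen_ball
    refine ⟨_, hopen.mem_nhds ⟨mem_chart_source _ x, Metric.mem_ball_self hr⟩, ?_⟩
    rw [volumeG_apply g x hopen.measurableSet Set.inter_subset_left]
    refine (lintegral_mono_set (t := Metric.closedBall (chartAt (ℰ n) x x) r) ?_).trans_lt ?_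
    · rintro y ⟨⟨-, h1⟩, h2⟩
      rw [Set.mem_preimage, (chartAt (ℰ n) x).right_inv h2] at h1
      exact Metric.ball_subset_closedBall h1
    · exact (((continuousOn_density g x).mono hball).integrableOn_compact
        (isCompact_closedBall _ _)).lintegral_lt_top

instance isOpenPosMeasure_volumeG : (volumeG g).IsOpenPosMeasure where
  open_pos U hU hne h0 := by
    obtain ⟨x, hx⟩ := hne
    have hS := (chartAt (ℰ n) x).open_source
    have h1 : volumeG g (U ∩ (chartAt (ℰ n) x).source) = 0 :=
      measure_mono_null Set.inter_subset_left h0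
    rw [volumeG_apply g x (hU.inter hS).measurableSet Set.inter_subset_right] at h1
    set W := (chartAt (ℰ n) x).symm ⁻¹' (U ∩ (chartAt (ℰ n) x).source) ∩
      (chartAt (ℰ n) x).target with hW
    have hWo : IsOpen W := by
      rw [hW, Set.inter_comm]
      exact (chartAt (ℰ n) x).symm.isOpen_inter_preimage (hU.inter hS)
    have hmem : chartAt (ℰ n) x x ∈ W := by
      refine ⟨?_, mem_chart_target _ x⟩
      rw [Set.mem_preimage, (chartAt (ℰ n) x).left_inv (mem_chart_source _ x)]
      exact ⟨hx, mem_chart_source _ x⟩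
    rw [lintegral_eq_zero_iff' ((((continuousOn_density g x).mono
      (fun y hy => hy.2)).aemeasurable hWo.measurableSet).ennreal_ofReal)] at h1
    rw [Filter.EventuallyEq, ae_restrict_iff' hWo.measurableSet] at h1
    have h2 : volume W = 0 := by
      rw [measure_eq_zero_iff_ae_notMem]
      filter_upwards [h1] with y hy hyW
      have := hy hyW
      rw [Pi.zero_apply, ENNReal.ofReal_eq_zero] at this
      exact absurd ((isCoordMetric_inner g x).density_pos hyW.2) (not_lt.2 this)
    exact (hWo.measure_pos volume ⟨_, hmem⟩).ne' h2

/-- Integration of a function supported in a chart domain. -/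
theorem integral_volumeG_eq (a : M) {f : M → ℝ} (hf : Continuous f)
    (hs : ∀ x, x ∉ (chartAt (ℰ n) a).source → f x = 0) :
    ∫ x, f x ∂(volumeG g) = ∫ y in (chartAt (ℰ n) a).target,
      density (tensorInChart (chartAt (ℰ n) a) g.inner) y * f ((chartAt (ℰ n) a).symm y) := by
  have ht := (chartAt (ℰ n) a).open_target.measurableSet
  rw [← setIntegral_eq_integral_of_forall_compl_eq_zero hs, volumeG_restrict_source, chartVolume,
    integral_map ((aemeasurable_chart_symm a).mono_ac (withDensity_absolutelyContinuous _ _))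
      hf.aestronglyMeasurable,
    integral_withDensity_eq_integral_toReal_smul₀]
  · refine setIntegral_congr_fun ht fun y hy => ?_
    change (ENNReal.ofReal (density (tensorInChart (chartAt (ℰ n) a) g.inner) y)).toReal • _ = _
    have h0 : 0 ≤ density (tensorInChart (chartAt (ℰ n) a) g.inner) y := Real.sqrt_nonneg _
    rw [ENNReal.toReal_ofReal h0, smul_eq_mul]
  · exact ((continuousOn_density g a).aemeasurable ht).ennreal_ofReal
  · exact Filter.Eventually.of_forall fun _ => ENNReal.ofReal_lt_top

end Volume

end ManifoldCalculus

/-! ### The divergence theorem -/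

section ManifoldCalculus

/-- The integral of a directional derivative of a function with compact support in an open set
vanishes. -/
theorem integral_fderiv_eq_zero {n : ℕ} {U K : Set (ℰ n)} (hU : IsOpen U) (hK : IsCompact K)
    (hKU : K ⊆ U) {h : ℰ n → ℝ} (hh : ContDiffOn ℝ ∞ h U) (h0 : ∀ y ∈ U, y ∉ K → h y = 0)
    (v : ℰ n) :
    IntegrableOn (fun y => fderiv ℝ h y v) U ∧ ∫ y in U, fderiv ℝ h y v = 0 := by
  -- The extension of `h` by zero is smooth with compact support.
  have hzero : ∀ y ∉ K, U.indicator h y = 0 := fun y hy => by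
    by_cases hyU : y ∈ U
    · rw [Set.indicator_of_mem hyU, h0 y hyU hy]
    · exact Set.indicator_of_notMem hyU _
  have heq : ∀ y ∈ U, U.indicator h =ᶠ[nhds y] h := fun y hy =>
    Filter.eventuallyEq_of_mem (hU.mem_nhds hy) fun z hz => Set.indicator_of_mem hz _
  have heq0 : ∀ y ∉ K, U.indicator h =ᶠ[nhds y] fun _ => 0 := fun y hy =>
    Filter.eventuallyEq_of_mem (hK.isClosed.isOpen_compl.mem_nhds hy) fun z hz => hzero z hz
  have hcd : ContDiff ℝ ∞ (U.indicator h) := contDiff_iff_contDiffAt.2 fun y => by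
    by_cases hyU : y ∈ U
    · exact (hh.contDiffAt (hU.mem_nhds hyU)).congr_of_eventuallyEq (heq y hyU)
    · exact contDiffAt_const.congr_of_eventuallyEq (heq0 y fun hy => hyU (hKU hy))
  have hcs : HasCompactSupport (U.indicator h) := HasCompactSupport.intro hK hzero
  have hder : ∀ y ∈ U, fderiv ℝ (U.indicator h) y v = fderiv ℝ h y v := fun y hy => by
    rw [(heq y hy).fderiv_eq]
  have hint' : Integrable (fun y => fderiv ℝ (U.indicator h) y v) :=
    ((hcd.continuous_fderiv (by simp)).clm_apply continuous_const).integrable_of_hasCompactSupport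
      (hcs.fderiv_apply ℝ v)
  refine ⟨hint'.integrableOn.congr_fun hder hU.measurableSet, ?_⟩
  rw [← setIntegral_congr_fun hU.measurableSet hder,
    setIntegral_eq_integral_of_forall_compl_eq_zero]
  · -- Integration by parts against the constant function `1`.
    have := integral_mul_fderiv_eq_neg_fderiv_mul_of_integrable (μ := volume) (𝕜 := ℝ)
      (f := fun _ : ℰ n => (1 : ℝ)) (g := U.indicator h) (v := v) (by simp) (by simpa using hint')
      (by simpa using hcd.continuous.integrable_of_hasCompactSupport hcs)
      (fun _ _ => differentiableAt_const _)
      (fun y _ => (hcd.differentiable (by simp)).differentiableAt)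
    simpa using this
  · intro y hy
    rw [(heq0 y fun hyK => hy (hKU hyK)).fderiv_eq]
    simp

variable {n : ℕ} {M : Type*} [TopologicalSpace M] [ChartedSpace (ℰ n) M] [IsManifold (𝓡 n) ∞ M]
  (g : Metric n M)

theorem SmoothOneForm.smul {α : OneForm n M} (hα : SmoothOneForm α) {ρ : M → ℝ}
    (hρ : ContMDiff (𝓡 n) 𝓘(ℝ, ℝ) ∞ ρ) : SmoothOneForm fun x => ρ x • α x := by
  rw [smoothOneForm_iff] at hα ⊢
  exact fun a => ((contMDiff_iff_chart ρ).1 hρ a).smul (hα a)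

theorem SmoothOneForm.differentiableAt {α : OneForm n M} (hα : SmoothOneForm α) (x : M) :
    DifferentiableAt ℝ (formInChart (chartAt (ℰ n) x) α) (chartAt (ℰ n) x x) :=
  (((smoothOneForm_iff α).1 hα x).contDiffAt ((chartAt (ℰ n) x).open_target.mem_nhds
    (mem_chart_target _ x))).differentiableAt (by simp)

theorem codiff_sum {ι : Type*} (s : Finset ι) {β : ι → OneForm n M}
    (hβ : ∀ i, SmoothOneForm (β i)) (x : M) :
    codiff g (fun x => ∑ i ∈ s, β i x) x = ∑ i ∈ s, codiff g (β i) x := by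
  have h : formInChart (chartAt (ℰ n) x) (fun x => ∑ i ∈ s, β i x)
      = fun y => ∑ i ∈ s, formInChart (chartAt (ℰ n) x) (β i) y := by
    ext y v
    simp [formInChart]
  simp only [codiff, coordCodiff, h]
  rw [fderiv_fun_sum fun i _ => (hβ i).differentiableAt x, Finset.sum_neg_distrib,
    Finset.sum_comm]
  simp only [sum_apply, Finset.sum_sub_distrib]

theorem codiff_eq_zero_of_eventually {β : OneForm n M} {x : M} (h : ∀ᶠ z in nhds x, β z = 0) :
    codiff g β x = 0 := by
  have hc : Filter.Tendsto (chartAt (ℰ n) x).symm (nhds (chartAt (ℰ n) x x)) (nhds x) := by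
    have := (chartAt (ℰ n) x).continuousAt_symm (mem_chart_target (ℰ n) x)
    rwa [ContinuousAt, (chartAt (ℰ n) x).left_inv (mem_chart_source _ x)] at this
  have h0 : formInChart (chartAt (ℰ n) x) β =ᶠ[nhds (chartAt (ℰ n) x x)] fun _ => 0 := by
    filter_upwards [hc.eventually h] with y hy
    rw [formInChart, hy, ContinuousLinearMap.zero_comp]
  simp [codiff, coordCodiff, h0.fderiv_eq, h0.eq_of_nhds]

variable [MeasurableSpace M] [BorelSpace M]

/-- The divergence theorem for one-forms with compact support in a chart domain. -/
theorem integral_codiff_eq_zero_of_support [T2Space M] {α : OneForm n M} (hα : SmoothOneForm α)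
    (a : M) {K : Set M} (hK : IsCompact K) (hKs : K ⊆ (chartAt (ℰ n) a).source)
    (h0 : ∀ x ∉ K, α x = 0) : ∫ x, codiff g α x ∂(volumeG g) = 0 := by
  have hG := isCoordMetric_inner g a
  have hαa := (smoothOneForm_iff α).1 hα a
  have hcod : ∀ x, x ∉ (chartAt (ℰ n) a).source → codiff g α x = 0 := fun x hx =>
    codiff_eq_zero_of_eventually g <| Filter.mem_of_superset
      (hK.isClosed.isOpen_compl.mem_nhds fun hxK => hx (hKs hxK)) h0
  set G := tensorInChart (chartAt (ℰ n) a) g.inner with hGdef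
  set A := formInChart (chartAt (ℰ n) a) α with hA
  have hK' : IsCompact (chartAt (ℰ n) a '' K) :=
    hK.image_of_continuousOn ((chartAt (ℰ n) a).continuousOn.mono hKs)
  have hKt : chartAt (ℰ n) a '' K ⊆ (chartAt (ℰ n) a).target := by
    rintro _ ⟨x, hx, rfl⟩
    exact (chartAt (ℰ n) a).map_source (hKs hx)
  have hstokes : ∀ i : Fin n, _ := fun i =>
    integral_fderiv_eq_zero (h := fun z => density G z * A z ((G z).inverse (coordForm i)))
      (chartAt (ℰ n) a).open_target hK' hKt
      (hG.smooth_density.mul (hαa.clm_apply (hG.smooth_inverse.clm_apply contDiffOn_const)))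
      (fun y hy hyK => by
        have : A y = 0 := by
          rw [hA, formInChart, h0, ContinuousLinearMap.zero_comp]
          exact fun hyK' => hyK ⟨_, hyK', (chartAt (ℰ n) a).right_inv hy⟩
        simp [this]) (coordVec i)
  rw [integral_volumeG_eq g a (smooth_codiff g hα).continuous hcod,
    setIntegral_congr_fun (chartAt (ℰ n) a).open_target.measurableSet
      (g := fun y => -∑ i, fderiv ℝ
        (fun z => density G z * A z ((G z).inverse (coordForm i))) y (coordVec i))
      (fun y hy => by
        rw [codiff_eq g hα a hy]
        exact hG.density_mul_coordCodiff hy ((hαa.contDiffAt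
          ((chartAt (ℰ n) a).open_target.mem_nhds hy)).differentiableAt (by simp))),
    integral_neg, integral_finsetSum _ fun i _ => (hstokes i).1,
    Finset.sum_eq_zero fun i _ => (hstokes i).2, neg_zero]

/-- The divergence theorem on a closed manifold. -/
theorem integral_codiff_eq_zero [T2Space M] [CompactSpace M] {α : OneForm n M}
    (hα : SmoothOneForm α) : ∫ x, codiff g α x ∂(volumeG g) = 0 := by
  obtain ⟨t, ht⟩ := CompactSpace.elim_nhds_subcover (fun x : M => (chartAt (ℰ n) x).source)
    fun x => (chartAt (ℰ n) x).open_source.mem_nhds (mem_chart_source _ x)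
  obtain ⟨ρ, hρ⟩ := SmoothPartitionOfUnity.exists_isSubordinate (𝓡 n) (isClosed_univ (X := M))
    (fun x : t => (chartAt (ℰ n) (x : M)).source) (fun x => (chartAt (ℰ n) (x : M)).open_source)
    (fun x _ => by
      have hx : x ∈ ⋃ z ∈ t, (chartAt (ℰ n) z).source := by rw [ht]; trivial
      simpa using hx)
  have hβ : ∀ i : t, SmoothOneForm fun x => ρ i x • α x := fun i => hα.smul (ρ i).contMDiff
  have hsum : α = fun x => ∑ i : t, ρ i x • α x := by
    funext x
    have h1 := ρ.sum_eq_one (Set.mem_univ x)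
    rw [finsum_eq_sum_of_fintype] at h1
    rw [← Finset.sum_smul, h1, one_smul]
  have hint : ∀ i : t, Integrable (codiff g fun x => ρ i x • α x) (volumeG g) := fun i =>
    (smooth_codiff g (hβ i)).continuous.integrable_of_hasCompactSupport
      (HasCompactSupport.of_compactSpace _)
  rw [hsum]
  simp only [codiff_sum g Finset.univ hβ]
  rw [integral_finsetSum _ fun i _ => hint i]
  refine Finset.sum_eq_zero fun i _ => integral_codiff_eq_zero_of_support g (hβ i) i
    (isClosed_tsupport (ρ i)).isCompact (hρ i) fun x hx => ?_
  rw [image_eq_zero_of_notMem_tsupport hx, zero_smul]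

end ManifoldCalculus

/-! ### Inner products and divergences of two-tensors -/

section ManifoldCalculus

section Algebra

variable {V : Type*} [NormedAddCommGroup V] [NormedSpace ℝ V] [FiniteDimensional ℝ V]

/-- The square of an endomorphism `P` that is self-adjoint for a positive definite form `b` has
nonnegative trace, which vanishes only for `P = 0`. -/
theorem trace_sq_nonneg_and_eq_zero (b : V →L[ℝ] V →L[ℝ] ℝ) (hsymm : ∀ u v, b u v = b v u)
    (hpos : ∀ v, v ≠ 0 → 0 < b v v) (P : V →ₗ[ℝ] V) (hP : ∀ u v, b (P u) v = b u (P v)) :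
    0 ≤ LinearMap.trace ℝ V (P ∘ₗ P) ∧ (LinearMap.trace ℝ V (P ∘ₗ P) = 0 → P = 0) := by
  let B : LinearMap.BilinForm ℝ V :=
    LinearMap.mk₂ ℝ (fun u v => b u v) (by simp) (by simp) (by simp) (by simp)
  have : Invertible (2 : ℝ) := invertibleOfNonzero two_ne_zero
  obtain ⟨e, he⟩ := LinearMap.BilinForm.exists_orthogonal_basis (B := B) ⟨fun u v => hsymm u v⟩
  have hrepr : ∀ v i, e.repr v i * b (e i) (e i) = b v (e i) := by
    intro v i
    conv_rhs => rw [← e.sum_repr v]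
    rw [map_sum, sum_apply, Finset.sum_eq_single i]
    · simp
    · intro j _ hji
      have h0 : b (e j) (e i) = 0 := he hji
      simp [h0]
    · simp
  have hbe : ∀ i, 0 < b (e i) (e i) := fun i => hpos _ (e.ne_zero i)
  have hnn : ∀ v, 0 ≤ b v v := fun v => by
    by_cases hv : v = 0
    · simp [hv]
    · exact (hpos v hv).le
  have htr : LinearMap.trace ℝ V (P ∘ₗ P) = ∑ i, b (P (e i)) (P (e i)) / b (e i) (e i) := by
    rw [LinearMap.trace_eq_matrix_trace ℝ e, Matrix.trace]
    refine Finset.sum_congr rfl fun i _ => ?_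
    rw [Matrix.diag_apply, LinearMap.toMatrix_apply, eq_div_iff (hbe i).ne', hrepr,
      LinearMap.comp_apply, hP]
  have hterm : ∀ i ∈ Finset.univ, 0 ≤ b (P (e i)) (P (e i)) / b (e i) (e i) := fun i _ =>
    div_nonneg (hnn _) (hbe i).le
  rw [htr]
  refine ⟨Finset.sum_nonneg hterm, fun h0 => e.ext fun i => ?_⟩
  by_contra hne
  exact (div_pos (hpos _ hne) (hbe i)).ne'
    ((Finset.sum_eq_zero_iff_of_nonneg hterm).1 h0 i (Finset.mem_univ i))

/-- The norm of a symmetric bilinear form `φ` with respect to a positive definite form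
`b` is definite. -/
theorem trace_inverse_comp_sq (b : V →L[ℝ] V →L[ℝ] ℝ) (hsymm : ∀ u v, b u v = b v u)
    (hpos : ∀ v, v ≠ 0 → 0 < b v v) (φ : V →L[ℝ] V →L[ℝ] ℝ) (hφ : ∀ u v, φ u v = φ v u) :
    0 ≤ LinearMap.trace ℝ V ((b.inverse.comp φ).comp (b.inverse.comp φ)).toLinearMap ∧
      (LinearMap.trace ℝ V ((b.inverse.comp φ).comp (b.inverse.comp φ)).toLinearMap = 0 →
        φ = 0) := by
  have hb := isInvertible_of_pos b hpos
  have hbi : ∀ w, b (b.inverse.comp φ w) = φ w := fun w => hb.self_apply_inverse _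
  obtain ⟨h1, h2⟩ := trace_sq_nonneg_and_eq_zero b hsymm hpos (b.inverse.comp φ).toLinearMap
    fun u v => by
      change b (b.inverse.comp φ u) v = b u (b.inverse.comp φ v)
      rw [hsymm u, hbi, hbi, hφ]
  refine ⟨h1, fun h0 => ContinuousLinearMap.ext fun v => ?_⟩
  have h3 : b.inverse.comp φ v = 0 := congrArg (fun L : V →ₗ[ℝ] V => L v) (h2 h0)
  rw [← hbi, h3, map_zero]
  rfl

end Algebra

variable {n : ℕ} {M : Type*} [TopologicalSpace M] [ChartedSpace (ℰ n) M] [IsManifold (𝓡 n) ∞ M]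

theorem lieFun_eq_fderiv_chart {f : M → ℝ} (hf : ContMDiff (𝓡 n) 𝓘(ℝ, ℝ) ∞ f) (a : M) {x : M}
    (hx : x ∈ (chartAt (ℰ n) a).source) (X : VField n M) :
    lieFun X f x = fderiv ℝ (fun z => f ((chartAt (ℰ n) a).symm z)) (chartAt (ℰ n) a x)
        (chartDeriv (chartAt (ℰ n) a) x (X x)) := by
  have hy := (chartAt (ℰ n) a).map_source hx
  have h := mfderiv_comp (I := 𝓘(ℝ, ℰ n)) (I' := 𝓡 n) (I'' := 𝓘(ℝ, ℝ)) (chartAt (ℰ n) a x)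
    (hf.mdifferentiable (by simp) _)
    ((mdifferentiable_chartAt a).mdifferentiableAt_symm hy)
  rw [mfderiv_eq_fderiv] at h
  refine Eq.trans ?_ (congrArg (fun L : ℰ n →L[ℝ] ℝ =>
    L (chartDeriv (chartAt (ℰ n) a) x (X x))) h).symm
  exact (form_congr (fun x => mfderiv (𝓡 n) 𝓘(ℝ, ℝ) f x) ((chartAt (ℰ n) a).left_inv hx)
    (chartSymmDeriv_chartDeriv a hx (X x))).symm

/-- A function with vanishing differential is constant on a connected manifold. -/
theorem eq_of_lieFun_eq_zero [PreconnectedSpace M] {f : M → ℝ}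
    (hf : ContMDiff (𝓡 n) 𝓘(ℝ, ℝ) ∞ f)
    (h : ∀ (X : VField n M) x, lieFun X f x = 0) (x x' : M) :
    f x = f x' := by
  refine IsLocallyConstant.apply_eq_of_isPreconnected
    ((IsLocallyConstant.iff_eventually_eq f).2 fun a => ?_) isPreconnected_univ trivial trivial
  have hsm := (contMDiff_iff_chart f).1 hf a
  obtain ⟨r, hr, hball⟩ := Metric.nhds_basis_ball.mem_iff.1
    ((chartAt (ℰ n) a).open_target.mem_nhds (mem_chart_target _ a))
  have hc := ((chartAt (ℰ n) a).continuousAt (mem_chart_source _ a)).preimage_mem_nhds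
    (Metric.ball_mem_nhds _ hr)
  filter_upwards [hc, (chartAt (ℰ n) a).open_source.mem_nhds (mem_chart_source _ a)] with z hz hz'
  have := (convex_ball (chartAt (ℰ n) a a) r).is_const_of_fderivWithin_eq_zero (𝕜 := ℝ)
    ((hsm.mono hball).differentiableOn (by simp)) (fun y hy => by
      rw [fderivWithin_of_isOpen Metric.isOpen_ball hy]
      ext v
      have h1 : (0 : ℝ) = fderiv ℝ (fun z => f ((chartAt (ℰ n) a).symm z))
          (chartAt (ℰ n) a ((chartAt (ℰ n) a).symm y))
          (chartDeriv (chartAt (ℰ n) a) ((chartAt (ℰ n) a).symm y)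
            (chartSymmDeriv (chartAt (ℰ n) a) y v)) :=
        (h (fun _ => (chartSymmDeriv (chartAt (ℰ n) a) y v : ℰ n)) _).symm.trans
          (lieFun_eq_fderiv_chart hf a ((chartAt (ℰ n) a).map_target (hball hy)) _)
      rw [chartDeriv_chartSymmDeriv a (hball hy), (chartAt (ℰ n) a).right_inv (hball hy)] at h1
      exact h1.symm) hz (Metric.mem_ball_self hr)
  simpa only [(chartAt (ℰ n) a).left_inv hz', (chartAt (ℰ n) a).left_inv (mem_chart_source _ a)]
    using this

variable (g : Metric n M)

theorem innerG_comm (φ ψ : TwoTensor n M) (x : M) : innerG g φ ψ x = innerG g ψ φ x :=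
  LinearMap.trace_mul_comm ℝ _ _

theorem innerG_add_left (φ ψ χ : TwoTensor n M) (x : M) :
    innerG g (fun x => φ x + ψ x) χ x = innerG g φ χ x + innerG g ψ χ x := by
  simp only [innerG, ContinuousLinearMap.comp_add, ContinuousLinearMap.toLinearMap_add, map_add]

/-- The pairing with a multiple of the metric is a multiple of the trace. -/
theorem innerG_smul_metric_left (f : M → ℝ) (φ : TwoTensor n M) (x : M) :
    innerG g (fun x => f x • g.inner x) φ x = f x * traceG g φ x := by
  have h : (g.inner x).inverse.comp (g.inner x) = ContinuousLinearMap.id ℝ _ :=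
    (isInvertible_inner g x).inverse_comp_self
  simp only [innerG, traceG, ContinuousLinearMap.comp_smul, h, ContinuousLinearMap.comp_id,
    ContinuousLinearMap.toLinearMap_smul, map_smul, smul_eq_mul]

theorem traceG_smul_sub (φ ψ : TwoTensor n M) (f : M → ℝ) (x : M) :
    traceG g (fun x => φ x - f x • ψ x) x = traceG g φ x - f x * traceG g ψ x := by
  simp only [traceG, ContinuousLinearMap.comp_sub, ContinuousLinearMap.comp_smul,
    ContinuousLinearMap.toLinearMap_sub, ContinuousLinearMap.toLinearMap_smul, map_sub,
    map_smul, smul_eq_mul]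

theorem traceG_metric (x : M) : traceG g g.inner x = n := by
  have h : (g.inner x).inverse.comp (g.inner x) = ContinuousLinearMap.id ℝ _ :=
    (isInvertible_inner g x).inverse_comp_self
  rw [traceG, h]
  refine (LinearMap.trace_id ℝ (ℰ n)).trans ?_
  rw [finrank_euclideanSpace_fin]

theorem traceG_ricci₀ (hn : n ≠ 0) (x : M) : traceG g (ricci₀ g) x = 0 := by
  have h := traceG_smul_sub g (ricci g) g.inner (fun x => scalarCurv g x / n) x
  rw [traceG_metric] at h
  refine h.trans ?_
  have : (n : ℝ) ≠ 0 := Nat.cast_ne_zero.2 hn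
  rw [← scalarCurv]
  field_simp
  ring

theorem innerG_self_nonneg {φ : TwoTensor n M} {x : M} (hφ : ∀ u v, φ x u v = φ x v u) :
    0 ≤ innerG g φ φ x :=
  (trace_inverse_comp_sq (V := ℰ n) (g.inner x) (g.symm x) (g.pos x) (φ x) hφ).1

theorem eq_zero_of_innerG_self {φ : TwoTensor n M} {x : M} (hφ : ∀ u v, φ x u v = φ x v u)
    (h : innerG g φ φ x = 0) : φ x = 0 :=
  (trace_inverse_comp_sq (V := ℰ n) (g.inner x) (g.symm x) (g.pos x) (φ x) hφ).2 h

theorem smooth_innerG {φ ψ : TwoTensor n M} (hφ : SmoothTwoTensor φ) (hψ : SmoothTwoTensor ψ) :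
    ContMDiff (𝓡 n) 𝓘(ℝ, ℝ) ∞ (innerG g φ ψ) := by
  rw [contMDiff_iff_chart]
  intro a
  have hG := isCoordMetric_inner g a
  have h1 := hG.smooth_inverse.clm_comp ((smoothTwoTensor_iff φ).1 hφ a)
  have h2 := hG.smooth_inverse.clm_comp ((smoothTwoTensor_iff ψ).1 hψ a)
  refine (ContDiffOn.sum (s := Finset.univ) fun i (_ : i ∈ Finset.univ) =>
    (contDiffOn_const (c := coordForm i)).clm_apply
      ((h2.clm_comp h1).clm_apply (contDiffOn_const (c := coordVec i)))).congr fun y hy => ?_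
  have hx := (chartAt (ℰ n) a).map_target hy
  rw [innerG_eq g φ ψ a hx _ _ (tensor_eq_pullForm φ a hx) (tensor_eq_pullForm ψ a hx),
    (chartAt (ℰ n) a).right_inv hy, ← sum_coordForm_eq_trace]
  rfl

theorem ricci_symm (x : M) (u v : TangentSpace (𝓡 n) x) : ricci g x u v = ricci g x v u :=
  (isCoordMetric_inner g x).coordRicci_symm (mem_chart_target _ x) _ _

theorem ricci₀_symm (x : M) (u v : TangentSpace (𝓡 n) x) : ricci₀ g x u v = ricci₀ g x v u := by
  change ricci g x u v - scalarCurv g x / n * g.inner x u v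
    = ricci g x v u - scalarCurv g x / n * g.inner x v u
  rw [ricci_symm, g.symm]

/-- The contracted Bianchi identity for the traceless Ricci tensor. -/
theorem divergence_ricci₀ (hn : n ≠ 0) (X : VField n M) (x : M) :
    divergence₂ g (ricci₀ g) x (X x)
      = -((n - 2 : ℝ) / (2 * n)) * lieFun X (scalarCurv g) x := by
  have hG := isCoordMetric_inner g x
  have hy := mem_chart_target (ℰ n) x
  have hU := (chartAt (ℰ n) x).open_target.mem_nhds hy
  set G := tensorInChart (chartAt (ℰ n) x) g.inner with hGdef
  have hT : tensorInChart (chartAt (ℰ n) x) (ricci₀ g) =ᶠ[nhds (chartAt (ℰ n) x x)]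
      fun z => coordRicci G z - (coordTrace G (coordRicci G) z * (n : ℝ)⁻¹) • G z := by
    filter_upwards [hU] with z hz
    refine (tensorInChart_smul_sub (ricci g) g.inner (fun x => scalarCurv g x / n) x z).trans ?_
    rw [tensorInChart_ricci g x hz, scalarCurv_eq g x hz, div_eq_mul_inv]
  have hs : (fun z => scalarCurv g ((chartAt (ℰ n) x).symm z)) =ᶠ[nhds (chartAt (ℰ n) x x)]
      coordTrace G (coordRicci G) := by
    filter_upwards [hU] with z hz using scalarCurv_eq g x hz
  have hS : DifferentiableAt ℝ (coordTrace G (coordRicci G)) (chartAt (ℰ n) x x) :=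
    ((hG.smooth_coordTrace hG.smooth_coordRicci).contDiffAt hU).differentiableAt (by simp)
  have hR : DifferentiableAt ℝ (coordRicci G) (chartAt (ℰ n) x x) :=
    (hG.smooth_coordRicci.contDiffAt hU).differentiableAt (by simp)
  have hS' := hS.mul_const (n : ℝ)⁻¹
  have hQ : DifferentiableAt ℝ (fun z => (coordTrace G (coordRicci G) z * (n : ℝ)⁻¹) • G z)
      (chartAt (ℰ n) x x) := hS'.fun_smul (hG.differentiableAt hy)
  have hn' : (n : ℝ) ≠ 0 := Nat.cast_ne_zero.2 hn
  rw [lieFun_eq_fderiv_chart (smooth_scalarCurv g) x (mem_chart_source _ x), hs.fderiv_eq,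
    divergence₂, coordDiv₂_congr _ hT, ← hGdef, coordDiv₂_sub G hR hQ,
    hG.coordDiv₂_coordRicci hy, hG.coordDiv₂_smul_metric hy hS']
  simp only [fderiv_mul_const hS, smul_apply, smul_eq_mul]
  field_simp
  ring

/-- The product rule `δ(φ(X, ·)) = (δφ)(X) - ½ ⟨φ, L_X g⟩`. -/
theorem codiff_contract {φ : TwoTensor n M} (hφ : SmoothTwoTensor φ)
    (hsymm : ∀ x u v, φ x u v = φ x v u) {X : VField n M} (hX : SmoothVField X) (x : M) :
    codiff g (fun x => φ x (X x)) x
      = divergence₂ g φ x (X x) - innerG g (fun x => (1 / 2 : ℝ) • lieMetric g X x) φ x := by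
  have hG := isCoordMetric_inner g x
  have hx := mem_chart_source (ℰ n) x
  have hy := mem_chart_target (ℰ n) x
  have hU := (chartAt (ℰ n) x).open_target.mem_nhds hy
  have hα : formInChart (chartAt (ℰ n) x) (fun x => φ x (X x)) =ᶠ[nhds (chartAt (ℰ n) x x)]
      fun z => tensorInChart (chartAt (ℰ n) x) φ z (vfieldInChart (chartAt (ℰ n) x) X z) := by
    filter_upwards [hU] with z hz
    ext v
    exact (tensor_congr φ rfl (chartSymmDeriv_chartDeriv_symm x hz (X _)) rfl).symm
  have hXx : ∀ x', x' = x → (chartDeriv (chartAt (ℰ n) x) x' (X x') : ℰ n)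
      = chartDeriv (chartAt (ℰ n) x) x (X x) := by
    rintro _ rfl
    rfl
  rw [innerG_eq g _ φ x hx ((1 / 2 : ℝ) • coordLie (tensorInChart (chartAt (ℰ n) x) g.inner)
    (vfieldInChart (chartAt (ℰ n) x) X) (chartAt (ℰ n) x x)) _ rfl (tensor_eq_pullForm φ x hx),
    codiff, coordCodiff_congr _ hα, hG.coordCodiff_contract hy
      ((((smoothTwoTensor_iff φ).1 hφ x).contDiffAt hU).differentiableAt (by simp))
      (fun z _ u v => hsymm _ _ _)
      ((((smoothVField_iff X).1 hX x).contDiffAt hU).differentiableAt (by simp)),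
    vfieldInChart, hXx _ ((chartAt (ℰ n) x).left_inv hx)]
  rfl

theorem smooth_contract {φ : TwoTensor n M} (hφ : SmoothTwoTensor φ)
    {X : VField n M} (hX : SmoothVField X) : SmoothOneForm fun x => φ x (X x) := by
  rw [smoothOneForm_iff]
  intro a
  refine (((smoothTwoTensor_iff φ).1 hφ a).clm_apply ((smoothVField_iff X).1 hX a)).congr
    fun z hz => ?_
  ext v
  exact (tensor_congr φ rfl (chartSymmDeriv_chartDeriv_symm a hz (X _)) rfl).symm

theorem SmoothTwoTensor.sub {φ ψ : TwoTensor n M} (hφ : SmoothTwoTensor φ)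
    (hψ : SmoothTwoTensor ψ) : SmoothTwoTensor fun x => φ x - ψ x := by
  rw [smoothTwoTensor_iff] at hφ hψ ⊢
  exact fun a => ((hφ a).sub (hψ a)).congr fun y _ => by ext u v; rfl

end ManifoldCalculus

/-! ### Rigidity of the decomposition of the traceless Ricci tensor -/

section ManifoldCalculus

variable {n : ℕ} {M : Type*} [TopologicalSpace M] [ChartedSpace (ℰ n) M]

theorem lieFun_eq_zero_of_const {f : M → ℝ} {c : ℝ} (h : ∀ x, f x = c) (X : VField n M) (x : M) :
    lieFun X f x = 0 := by
  obtain rfl : f = fun _ => c := funext h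
  rw [lieFun, mfderiv_const]
  rfl

variable [IsManifold (𝓡 n) ∞ M] (g : Metric n M)

/-- The integrand identity behind the rigidity of `Sθ`: integrating
`⟨Ric₀, Sθ⟩ = (δRic₀)(θ^♯) - δ(Ric₀(θ^♯, ·))` leaves only a multiple of `∫ ds(θ^♯)`. -/
theorem innerG_cauchyAhlfors_ricci₀ (hn : n ≠ 0) {θ : OneForm n M} (hθ : SmoothOneForm θ) (x : M) :
    innerG g (cauchyAhlfors g θ) (ricci₀ g) x
      = -((n - 2 : ℝ) / (2 * n)) * lieFun (sharp g θ) (scalarCurv g) x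
        - codiff g (fun x => ricci₀ g x (sharp g θ x)) x := by
  have h1 := innerG_add_left g (deltaStar g θ)
    (fun x => ((1 / n : ℝ) * codiff g θ x) • g.inner x) (ricci₀ g) x
  rw [innerG_smul_metric_left, traceG_ricci₀ g hn, mul_zero, add_zero] at h1
  have h2 := codiff_contract g (smooth_ricci₀ g) (ricci₀_symm g) (smooth_sharp g hθ) x
  rw [divergence_ricci₀ g hn] at h2
  refine h1.trans ?_
  rw [h2, sub_sub_cancel]
  rfl

theorem isConformalKilling_of_cauchyAhlfors_eq_zero {θ : OneForm n M}
    (hθ : SmoothOneForm θ) (h : ∀ x, cauchyAhlfors g θ x = 0) :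
    IsConformalKilling g (sharp g θ) := by
  refine ⟨smooth_sharp g hθ, fun x => (-2 / n : ℝ) * codiff g θ x,
    contMDiff_const.mul (smooth_codiff g hθ), fun x => ?_⟩
  have h1 : (1 / 2 : ℝ) • lieMetric g (sharp g θ) x
      + ((1 / n : ℝ) * codiff g θ x) • g.inner x = 0 := h x
  have h2 : lieMetric g (sharp g θ) x = (2 : ℝ) • ((1 / 2 : ℝ) • lieMetric g (sharp g θ) x) := by
    rw [smul_smul]
    norm_num
  rw [h2, eq_neg_of_add_eq_zero_left h1, ← neg_smul, smul_smul]
  congr 1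
  ring

theorem const_scalarCurv_iff_exists_isTT [ConnectedSpace M] (hn : 3 ≤ n) :
    (∃ c : ℝ, ∀ x, scalarCurv g x = c) ↔
      ∃ φ : TwoTensor n M, IsTT g φ ∧
        ∀ x, ricci g x = (scalarCurv g x / n) • g.inner x + φ x := by
  have hn0 : n ≠ 0 := by omega
  constructor
  · rintro ⟨c, hc⟩
    refine ⟨ricci₀ g, ⟨smooth_ricci₀ g, ricci₀_symm g, traceG_ricci₀ g hn0, fun x w => ?_⟩,
      fun x => (add_sub_cancel _ _).symm⟩
    -- All tangent spaces are copies of `ℝⁿ`, so that `w` extends to a vector field.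
    refine (divergence_ricci₀ g hn0 (fun _ => (w : ℰ n)) x).trans ?_
    exact mul_eq_zero_of_right _ (lieFun_eq_zero_of_const hc _ x)
  · rintro ⟨φ, hφ, h⟩
    obtain rfl : φ = ricci₀ g := funext fun x => (sub_eq_of_eq_add' (h x)).symm
    have hds : ∀ (X : VField n M) x, lieFun X (scalarCurv g) x = 0 := by
      intro X x
      have h1 := divergence_ricci₀ g hn0 X x
      rw [hφ.divFree, eq_comm, mul_eq_zero, neg_eq_zero] at h1
      refine h1.resolve_left (div_ne_zero ?_ ?_)
      · have : (3 : ℝ) ≤ n := by exact_mod_cast hn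
        linarith
      · positivity
    obtain ⟨x₀⟩ : Nonempty M := inferInstance
    exact ⟨scalarCurv g x₀, fun x => eq_of_lieFun_eq_zero (smooth_scalarCurv g) hds x x₀⟩

variable [MeasurableSpace M] [BorelSpace M]

/-- Since `Sθ` is orthogonal to the TT-part of `Ric₀`, its `L²` norm squared is `∫ ⟨Ric₀, Sθ⟩`,
which is a multiple of `∫ ds(θ^♯) = 0`. -/
theorem cauchyAhlfors_eq_zero [T2Space M] [CompactSpace M] (hn : n ≠ 0) {θ : OneForm n M}
    {φ : TwoTensor n M} (hθ : SmoothOneForm θ) (hφ : SmoothTwoTensor φ)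
    (hsymm : ∀ x u v, φ x u v = φ x v u) (hdec : ∀ x, ricci₀ g x = cauchyAhlfors g θ x + φ x)
    (horth : innerL2 g (cauchyAhlfors g θ) φ = 0)
    (hint : ∫ x, lieFun (sharp g θ) (scalarCurv g) x ∂(volumeG g) = 0) (x : M) :
    cauchyAhlfors g θ x = 0 := by
  -- Smoothness and symmetry of `Sθ` are read off from the decomposition.
  have hS : cauchyAhlfors g θ = fun x => ricci₀ g x - φ x :=
    funext fun x => eq_sub_of_add_eq (hdec x).symm
  have hSsm : SmoothTwoTensor (cauchyAhlfors g θ) := hS ▸ (smooth_ricci₀ g).sub hφ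
  have hSsymm : ∀ x u v, cauchyAhlfors g θ x u v = cauchyAhlfors g θ x v u := fun x u v => by
    have h : ∀ u v, cauchyAhlfors g θ x u v = ricci₀ g x u v - φ x u v := fun u v => by
      rw [hS]
      rfl
    rw [h, h, ricci₀_symm, hsymm]
  have hα := smooth_contract (smooth_ricci₀ g) (smooth_sharp g hθ)
  have hcont : ∀ f : M → ℝ, ContMDiff (𝓡 n) 𝓘(ℝ, ℝ) ∞ f → Integrable f (volumeG g) := fun f hf =>
    hf.continuous.integrable_of_hasCompactSupport (HasCompactSupport.of_compactSpace _)
  have hsmSS := smooth_innerG g hSsm hSsm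
  have hi1 := hcont _ hsmSS
  have hi2 := hcont _ (smooth_innerG g hSsm hφ)
  have hi3 := hcont _ (smooth_codiff g hα)
  have hpt : ∀ x, innerG g (cauchyAhlfors g θ) (cauchyAhlfors g θ) x
      + innerG g (cauchyAhlfors g θ) φ x + codiff g (fun x => ricci₀ g x (sharp g θ x)) x
      = -((n - 2 : ℝ) / (2 * n)) * lieFun (sharp g θ) (scalarCurv g) x := fun x => by
    have h1 := innerG_cauchyAhlfors_ricci₀ g hn hθ x
    have h2 : innerG g (cauchyAhlfors g θ) (ricci₀ g) x
        = innerG g (cauchyAhlfors g θ) (cauchyAhlfors g θ) x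
          + innerG g (cauchyAhlfors g θ) φ x := by
      rw [innerG_comm, innerG_comm g (cauchyAhlfors g θ) φ, ← innerG_add_left, funext hdec]
    linarith
  have hzero : ∫ x, innerG g (cauchyAhlfors g θ) (cauchyAhlfors g θ) x ∂(volumeG g) = 0 := by
    have h := integral_congr_ae (μ := volumeG g) (Filter.Eventually.of_forall hpt)
    rw [integral_add (by exact hi1.add hi2) hi3, integral_add hi1 hi2, integral_codiff_eq_zero g hα,
      integral_const_mul, hint, mul_zero, add_zero] at h
    have h' : ∫ x, innerG g (cauchyAhlfors g θ) φ x ∂(volumeG g) = 0 := horth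
    rwa [h', add_zero] at h
  rw [integral_eq_zero_iff_of_nonneg (fun x => innerG_self_nonneg g (hSsymm x)) hi1,
    hsmSS.continuous.ae_eq_iff_eq (volumeG g) continuous_zero] at hzero
  exact eq_zero_of_innerG_self g (hSsymm x) (congrFun hzero x)

theorem isConformalKilling_and_eq_ricci₀ [T2Space M] [CompactSpace M] (hn : n ≠ 0) {θ : OneForm n M}
    {φ : TwoTensor n M} (hθ : SmoothOneForm θ) (hφ : IsTT g φ)
    (hdec : ∀ x, ricci₀ g x = cauchyAhlfors g θ x + φ x)
    (horth : innerL2 g (cauchyAhlfors g θ) φ = 0)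
    (hs : ∫ x, lieFun (sharp g θ) (scalarCurv g) x ∂(volumeG g) = 0 ∨
      ∃ c : ℝ, ∀ x, scalarCurv g x = c) :
    IsConformalKilling g (sharp g θ) ∧ ∀ x, φ x = ricci₀ g x := by
  have hint : ∫ x, lieFun (sharp g θ) (scalarCurv g) x ∂(volumeG g) = 0 := by
    rcases hs with h | ⟨c, hc⟩
    · exact h
    · simp [lieFun_eq_zero_of_const hc]
  have hS := cauchyAhlfors_eq_zero g hn hθ hφ.smooth hφ.symm hdec horth hint
  refine ⟨isConformalKilling_of_cauchyAhlfors_eq_zero g hθ hS, fun x => ?_⟩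
  rw [hdec, hS, zero_add]

end ManifoldCalculus

end RiemGeom

end

theorem corollary1 (n : ℕ) (hn : 3 ≤ n)
    {M : Type*} [TopologicalSpace M] [T2Space M] [CompactSpace M]
    [ChartedSpace (EuclideanSpace ℝ (Fin n)) M] [IsManifold (𝓡 n) ∞ M]
    [MeasurableSpace M] [BorelSpace M] (g : RiemGeom.Metric n M) :
    (∀ (θ : RiemGeom.OneForm n M) (φ : RiemGeom.TwoTensor n M),
      RiemGeom.SmoothOneForm θ →
      RiemGeom.IsTT g φ →
      (∀ x, RiemGeom.ricci₀ g x = RiemGeom.cauchyAhlfors g θ x + φ x) →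
      RiemGeom.innerL2 g (RiemGeom.cauchyAhlfors g θ) φ = 0 →
      ((∫ x, RiemGeom.lieFun (RiemGeom.sharp g θ) (RiemGeom.scalarCurv g) x
            ∂(RiemGeom.volumeG g) = 0) ∨
        (∃ c : ℝ, ∀ x, RiemGeom.scalarCurv g x = c)) →
      RiemGeom.IsConformalKilling g (RiemGeom.sharp g θ) ∧
        ∀ x, φ x = RiemGeom.ricci₀ g x) ∧
    (ConnectedSpace M →
      ((∃ c : ℝ, ∀ x, RiemGeom.scalarCurv g x = c) ↔
        ∃ φ : RiemGeom.TwoTensor n M, RiemGeom.IsTT g φ ∧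
          ∀ x, RiemGeom.ricci g x
            = (RiemGeom.scalarCurv g x / n) • g.inner x + φ x)) :=
  ⟨fun _ _ hθ hφ hdec horth hs => RiemGeom.isConformalKilling_and_eq_ricci₀ g (by omega) hθ hφ
    hdec horth hs, fun _ => RiemGeom.const_scalarCurv_iff_exists_isTT g hn⟩
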